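/- **Setting.** Fix a nonzero complex number $t^{1/4}$ and set $t^{1/2}=(t^{1/4})^2$. Let $A=\{z\in\mathbb C: 1\le |z|\le 2\}$. An $(m,n)$-tangle diagram in $A$ has $m$ equally spaced endpoints on the inner circle and $n$ on the outer circle, labelled counterclockwise starting from the positive real axis, and is considered up to planar isotopy of $A$ fixing the boundary. The skein category $\mathcal S$ of the annulus is the $\mathbb C$-linear category with objects $\mathbb Z_{\ge 0}$ in which $\mathrm{Hom}_{\mathcal S}(m,n)$ is the complex vector space spanned by the $(m,n)$-tangle diagrams, modulo the Kauffman skein relation (a crossing, viewed so that the overcrossing strand runs from lower left to upper right, equals $t^{1/4}$ times the smoothing that joins its two upper ends and its two lower ends, plus $t^{-1/4}$ times the smoothing that joins its two left ends and its two right ends) and the relation that a contractible loop may be removed at the cost of a factor $-(t^{1/2}+t^{-1/2})$. Composition $D'\circ D$ places $D$ inside $D'$. Let $\mathrm{TL}_n:=\mathrm{End}_{\mathcal S}(n)$ be the $n$th extended affine Temperley–Lieb algebra. Let $X\in \mathrm{End}_{\mathcal S}(0)$ be the class of the noncontractible loop and $\rho\in\mathrm{End}_{\mathcal S}(1)$ the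 class of a single strand from the inner to the outer boundary winding once counterclockwise. For $k\ge 0$, $u\in\mathbb C$ and $v\in\mathbb C^\ast$ define $$V_{2k}(u)=\mathrm{Hom}_{\mathcal S}(0,2k)\otimes_{\mathbb C[X]}\mathbb C^{(u)},\qquad V_{2k+1}(v)=\mathrm{Hom}_{\mathcal S}(1,2k+1)\otimes_{\mathbb C[\rho^{\pm1}]}\mathbb C^{(v)},$$ where $X$ acts on $\mathbb C^{(u)}=\mathbb C$ by $u$ and $\rho$ acts on $\mathbb C^{(v)}=\mathbb C$ by $v$; these are left modules over $\mathrm{TL}_{2k}$ and $\mathrm{TL}_{2k+1}$ by composition. For tangle diagrams $D,D'$ let $D\ast D'$ be the diagram obtained by compressing the endpoints of $D$ clockwise to the first positions and those of $D'$ counterclockwise to the last positions (neither through the seam just before the positive real axis) and placing $D$ on top of $D'$. Let $\epsilon_{n,m}:\mathrm{TL}_n\otimes\mathrm{TL}_m\to\mathrm{TL}_{n+m}$ be the algebra map $[D]\otimes[D']\mapsto[D\ast D']$. The fusion product of a left $\mathrm{TL}_n$-module $M_1$ and a left $\mathrm{TL}_m$-module $M_2$ is the induced left $\mathrm{TL}_{n+m}$-module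 $$M_1\,\widehat\times_f\, M_2:=\mathrm{TL}_{n+m}\otimes_{\mathrm{TL}_n\otimes\mathrm{TL}_m}(M_1\otimes M_2),$$ where $\mathrm{TL}_n\otimes\mathrm{TL}_m$ acts on $\mathrm{TL}_{n+m}$ from the right through $\epsilon_{n,m}$. **Corollary.** Let $v\in\mathbb C^\ast$ with $v^2\neq t^{1/2}$ and let $u=t^{1/4}v+t^{-1/4}v^{-1}$. Then for all $k\ge 0$ the left $\mathrm{TL}_{2k+1}$-module $V_{2k+1}(v)$ is a quotient of $V_{2k}(u)\,\widehat\times_f\, V_1(v)$, and the left $\mathrm{TL}_{2k+2}$-module $V_{2k+2}(u)$ is a quotient of $V_{2k+1}(v)\,\widehat\times_f\, V_1(v^{-1})$; that is, there are surjective homomorphisms of $\mathrm{TL}_{2k+1}$-modules, respectively $\mathrm{TL}_{2k+2}$-modules, $$V_{2k}(u)\,\widehat\times_f\, V_1(v)\twoheadrightarrow V_{2k+1}(v),\qquad V_{2k+1}(v)\,\widehat\times_f\, V_1(v^{-1})\twoheadrightarrow V_{2k+2}(u).$$ -/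

import Mathlib

open scoped TensorProduct

noncomputable section

namespace AnnularSkein

/-! ### Tangle diagrams on the annulus

A tangle diagram in general position with respect to the radial coordinate is cut by concentric
circles into finitely many elementary annular diagrams.  The marked points on a circle are labelled
`0, 1, 2, …` counterclockwise, starting at the positive real half-line; just before that half-line
runs the seam, which lies between the last and the first marked point.  Elementary diagrams are: one
local piece (cup, cap or crossing) placed beside straight radial strands away from the seam, or a
rotation, in which every strand moves one place counterclockwise and the last one passes through
the seam. -/

/-- Local pieces of a tangle diagram: a cup creates two adjacent points on the outer side, a cap
joins two adjacent points of the inner side, and there are two kinds of crossings.  In `pos`,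
the strand from inner point `i` to outer point `i + 1` runs *under* the strand from inner point
`i + 1` to outer point `i`; in `neg` it runs *over* it. -/
inductive Piece : Type
  | cup
  | cap
  | pos
  | neg

/-- Number of endpoints of a local piece on the inner side. -/
def Piece.src : Piece → ℕ
  | .cup => 0
  | .cap => 2
  | .pos => 2
  | .neg => 2

/-- Number of endpoints of a local piece on the outer side. -/
def Piece.tgt : Piece → ℕ
  | .cup => 2
  | .cap => 0
  | .pos => 2
  | .neg => 2

/-- Elementary annular tangle diagrams with `a` inner and `b` outer endpoints.
`box e i r` is the piece `e` with `i` radial strands before and `r` radial strands after it.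
`rot n` joins the inner point `j` to the outer point `j + 1` for `j + 1 < n`, and the last inner
point to the outer point `0` by a strand running counterclockwise through the seam.
`rotInv n` is its mirror image, turning clockwise. -/
inductive Slice : ℕ → ℕ → Type
  | box {a b : ℕ} (e : Piece) (i r : ℕ) (ha : a = i + e.src + r) (hb : b = i + e.tgt + r) :
      Slice a b
  | rot (n : ℕ) : Slice n n
  | rotInv (n : ℕ) : Slice n n

/-- `(a, b)`-tangle diagrams on the annulus, as stacks of elementary diagrams; in `cons s D` the
slice `s` lies outside the diagram `D`. -/
inductive Diagram : ℕ → ℕ → Type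
  | nil (n : ℕ) : Diagram n n
  | cons {a b c : ℕ} (s : Slice b c) (D : Diagram a b) : Diagram a c

namespace Diagram

/-- `D'.comp D` is the diagram obtained by placing `D` inside `D'`. -/
def comp {a b : ℕ} : {c : ℕ} → Diagram b c → Diagram a b → Diagram a c
  | _, nil _, D => D
  | _, cons s D', D => cons s (comp D' D)

theorem comp_nil {a b : ℕ} (D : Diagram a b) : D.comp (nil a) = D := by
  induction D with
  | nil => rfl
  | cons s D ih => simp [comp, ih]

theorem comp_assoc {a b c d : ℕ} (D₃ : Diagram c d) (D₂ : Diagram b c) (D₁ : Diagram a b) :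
    (D₃.comp D₂).comp D₁ = D₃.comp (D₂.comp D₁) := by
  induction D₃ with
  | nil => rfl
  | cons s D ih => simp [comp, ih]

/-- A single slice as a diagram. -/
def ofSlice {a b : ℕ} (s : Slice a b) : Diagram a b := cons s (nil a)

/-- The diagram consisting of one local piece beside radial strands. -/
def box {a b : ℕ} (e : Piece) (i r : ℕ) (ha : a = i + e.src + r) (hb : b = i + e.tgt + r) :
    Diagram a b := ofSlice (.box e i r ha hb)

/-- The rotation diagram, turning `n` strands counterclockwise by one place. -/
def rot (n : ℕ) : Diagram n n := ofSlice (.rot n)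

/-- The clockwise rotation diagram. -/
def rotInv (n : ℕ) : Diagram n n := ofSlice (.rotInv n)

/-- The `j`-fold rotation. -/
def rotPow (n : ℕ) : ℕ → Diagram n n
  | 0 => nil n
  | j + 1 => (rot n).comp (rotPow n j)

/-- The diagram with `n` strands in which strand `i` moves outwards to place `i + s`, crossing the
`s` strands in between by crossings of type `pos` (so it runs under them). -/
def sweepPos (n i : ℕ) : (s : ℕ) → i + s + 1 ≤ n → Diagram n n
  | 0, _ => nil n
  | s + 1, h =>
      (box .pos (i + s) (n - 2 - (i + s)) (by grind [Piece.src])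
        (by grind [Piece.tgt])).comp (sweepPos n i s (by omega))

/-- As `sweepPos`, but with the moving strand running over the others. -/
def sweepNeg (n i : ℕ) : (s : ℕ) → i + s + 1 ≤ n → Diagram n n
  | 0, _ => nil n
  | s + 1, h =>
      (box .neg (i + s) (n - 2 - (i + s)) (by grind [Piece.src])
        (by grind [Piece.tgt])).comp (sweepNeg n i s (by omega))

/-- The mirror of `sweepPos`: strand `i + s` moves back to place `i`, running under the others. -/
def sweepPosInv (n i : ℕ) : (s : ℕ) → i + s + 1 ≤ n → Diagram n n
  | 0, _ => nil n
  | s + 1, h =>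
      (sweepPosInv n i s (by omega)).comp (box .neg (i + s) (n - 2 - (i + s))
        (by grind [Piece.src]) (by grind [Piece.tgt]))

/-- The mirror of `sweepNeg`: strand `i + s` moves back to place `i`, running over the others. -/
def sweepNegInv (n i : ℕ) : (s : ℕ) → i + s + 1 ≤ n → Diagram n n
  | 0, _ => nil n
  | s + 1, h =>
      (sweepNegInv n i s (by omega)).comp (box .pos (i + s) (n - 2 - (i + s))
        (by grind [Piece.src]) (by grind [Piece.tgt]))

end Diagram

open Diagram

/-- `s ∗ Id_m` for an elementary diagram: `m` strands are inserted underneath `s`, between the last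
strand and the seam.  Where a strand of `s` passes through the seam, it first crosses over the
inserted strands. -/
def Slice.starId (m : ℕ) : {a b : ℕ} → Slice a b → Diagram (a + m) (b + m)
  | _, _, .box e i r ha hb => Diagram.box e i (r + m) (by omega) (by omega)
  | 0, _, .rot _ => nil (0 + m)
  | n + 1, _, .rot _ =>
      (Diagram.rot (n + 1 + m)).comp (sweepNeg (n + 1 + m) n m (by omega))
  | 0, _, .rotInv _ => nil (0 + m)
  | n + 1, _, .rotInv _ =>
      (sweepNegInv (n + 1 + m) n m (by omega)).comp (Diagram.rotInv (n + 1 + m))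

/-- `Id_k ∗ s` for an elementary diagram: `k` strands are inserted on top of `s`, between the
seam and the first strand.  A strand of `s` coming through the seam passes under them. -/
def Slice.idStar (k : ℕ) : {a b : ℕ} → Slice a b → Diagram (k + a) (k + b)
  | _, _, .box e i r ha hb => Diagram.box e (k + i) r (by omega) (by omega)
  | 0, _, .rot _ => nil (k + 0)
  | n + 1, _, .rot _ =>
      (sweepPos (k + (n + 1)) 0 k (by omega)).comp (Diagram.rot (k + (n + 1)))
  | 0, _, .rotInv _ => nil (k + 0)
  | n + 1, _, .rotInv _ =>
      (Diagram.rotInv (k + (n + 1))).comp (sweepPosInv (k + (n + 1)) 0 k (by omega))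

namespace Diagram

/-- The diagram `D ∗ Id_m`. -/
def starId (m : ℕ) {a : ℕ} : {b : ℕ} → Diagram a b → Diagram (a + m) (b + m)
  | _, nil _ => nil (a + m)
  | _, cons s D => (s.starId m).comp (starId m D)

/-- The diagram `Id_k ∗ D`. -/
def idStar (k : ℕ) {a : ℕ} : {b : ℕ} → Diagram a b → Diagram (k + a) (k + b)
  | _, nil _ => nil (k + a)
  | _, cons s D => (s.idStar k).comp (idStar k D)

/-- The diagram `D ∗ D'`: `D` is compressed clockwise, `D'` counterclockwise, neither of them
across the seam, and `D` is placed on top of `D'`. -/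
def star {k l m n : ℕ} (D : Diagram k l) (D' : Diagram m n) : Diagram (k + m) (l + n) :=
  (starId n D).comp (idStar k D')

/-- Elementary planar isotopies of the annulus (fixing the boundary) between stacks of elementary
diagrams. -/
inductive Move : {a b : ℕ} → Diagram a b → Diagram a b → Prop
  /-- Pieces at disjoint places may be moved past each other. -/
  | interchange {a b c d : ℕ} (e e' : Piece) (i j r : ℕ)
      (ha : a = i + e.src + j + e'.src + r) (hb : b = i + e.src + j + e'.tgt + r)
      (hc : c = i + e.tgt + j + e'.src + r) (hd : d = i + e.tgt + j + e'.tgt + r) :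
      Move
        ((box (a := b) (b := d) e i (j + e'.tgt + r) (by omega) (by omega)).comp
          (box (a := a) (b := b) e' (i + e.src + j) r (by omega) (by omega)))
        ((box (a := c) (b := d) e' (i + e.tgt + j) r (by omega) (by omega)).comp
          (box (a := a) (b := c) e i (j + e'.src + r) (by omega) (by omega)))
  /-- A piece followed by at least one radial strand may be pulled through a rotation. -/
  | rot_box {a b : ℕ} (e : Piece) (i r : ℕ)
      (ha : a = i + e.src + (r + 1)) (hb : b = i + e.tgt + (r + 1)) :
      Move ((rot b).comp (box e i (r + 1) ha hb))
        ((box e (i + 1) r (by omega) (by omega)).comp (rot a))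
  /-- A piece in the last place may be rotated as a whole across the seam. -/
  | rot_wrap {a b : ℕ} (e : Piece) (i : ℕ) (ha : a = i + e.src) (hb : b = i + e.tgt) :
      Move ((rotPow b e.tgt).comp (box e i 0 (by omega) (by omega)))
        ((box e 0 i (by omega) (by omega)).comp (rotPow a e.src))
  | rot_rotInv (n : ℕ) : Move ((rot n).comp (rotInv n)) (nil n)
  | rotInv_rot (n : ℕ) : Move ((rotInv n).comp (rot n)) (nil n)
  /-- Rotating no strand at all is the empty diagram. -/
  | rot_zero : Move (rot 0) (nil 0)
  /-- Straightening of zigzags. -/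
  | zigzag_left (i r : ℕ) :
      Move ((box (b := i + 1 + r) .cap i (r + 1) rfl (by grind [Piece.tgt])).comp
          (box (a := i + 1 + r) .cup (i + 1) r (by grind [Piece.src])
            (by grind [Piece.src, Piece.tgt])))
        (nil (i + 1 + r))
  | zigzag_right (i r : ℕ) :
      Move ((box (b := i + 1 + r) .cap (i + 1) r rfl (by grind [Piece.tgt])).comp
          (box (a := i + 1 + r) .cup i (r + 1) (by grind [Piece.src])
            (by grind [Piece.src, Piece.tgt])))
        (nil (i + 1 + r))
  /-- Turning a crossing by a quarter along a cap or a cup. -/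
  | cap_pos (i r : ℕ) :
      Move ((box (a := i + 3 + r) (b := i + 1 + r) .cap i (r + 1)
            (by grind [Piece.src]) (by grind [Piece.tgt])).comp
          (box (a := i + 3 + r) .pos (i + 1) r
            (by grind [Piece.src]) (by grind [Piece.tgt])))
        ((box (a := i + 3 + r) (b := i + 1 + r) .cap (i + 1) r
            (by grind [Piece.src]) (by grind [Piece.tgt])).comp
          (box (a := i + 3 + r) .neg i (r + 1)
            (by grind [Piece.src]) (by grind [Piece.tgt])))
  | cap_neg (i r : ℕ) :
      Move ((box (a := i + 3 + r) (b := i + 1 + r) .cap i (r + 1)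
            (by grind [Piece.src]) (by grind [Piece.tgt])).comp
          (box (a := i + 3 + r) .neg (i + 1) r
            (by grind [Piece.src]) (by grind [Piece.tgt])))
        ((box (a := i + 3 + r) (b := i + 1 + r) .cap (i + 1) r
            (by grind [Piece.src]) (by grind [Piece.tgt])).comp
          (box (a := i + 3 + r) .pos i (r + 1)
            (by grind [Piece.src]) (by grind [Piece.tgt])))
  | pos_cup (i r : ℕ) :
      Move ((box (a := i + 3 + r) (b := i + 3 + r) .pos (i + 1) r
            (by grind [Piece.src]) (by grind [Piece.tgt])).comp
          (box (a := i + 1 + r) .cup i (r + 1)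
            (by grind [Piece.src]) (by grind [Piece.tgt])))
        ((box (a := i + 3 + r) (b := i + 3 + r) .neg i (r + 1)
            (by grind [Piece.src]) (by grind [Piece.tgt])).comp
          (box (a := i + 1 + r) .cup (i + 1) r
            (by grind [Piece.src]) (by grind [Piece.tgt])))
  | neg_cup (i r : ℕ) :
      Move ((box (a := i + 3 + r) (b := i + 3 + r) .neg (i + 1) r
            (by grind [Piece.src]) (by grind [Piece.tgt])).comp
          (box (a := i + 1 + r) .cup i (r + 1)
            (by grind [Piece.src]) (by grind [Piece.tgt])))
        ((box (a := i + 3 + r) (b := i + 3 + r) .pos i (r + 1)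
            (by grind [Piece.src]) (by grind [Piece.tgt])).comp
          (box (a := i + 1 + r) .cup (i + 1) r
            (by grind [Piece.src]) (by grind [Piece.tgt])))

end Diagram

/-! ### The skein category of the annulus -/

/-- Formal complex linear combinations of `(a, b)`-tangle diagrams. -/
abbrev Formal (a b : ℕ) : Type := Diagram a b →₀ ℂ

/-- Composition of formal linear combinations of diagrams, bilinearly extended. -/
def Formal.comp {a b c : ℕ} : Formal b c →ₗ[ℂ] Formal a b →ₗ[ℂ] Formal a c :=
  Finsupp.lsum ℂ fun D' => LinearMap.toSpanSingleton ℂ (Formal a b →ₗ[ℂ] Formal a c)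
    (Finsupp.lmapDomain ℂ ℂ fun D => D'.comp D)

theorem Formal.comp_single {a b c : ℕ} (D' : Diagram b c) (D : Diagram a b) (x y : ℂ) :
    Formal.comp (Finsupp.single D' x) (Finsupp.single D y) =
      Finsupp.single (D'.comp D) (x * y) := by
  simp [Formal.comp, LinearMap.toSpanSingleton_apply]

theorem Formal.comp_assoc {a b c d : ℕ} (z : Formal c d) (y : Formal b c) (x : Formal a b) :
    Formal.comp (Formal.comp z y) x = Formal.comp z (Formal.comp y x) := by
  induction z using Finsupp.induction_linear with
  | zero => simp
  | add f g hf hg => simp [hf, hg]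
  | single D₃ z =>
    induction y using Finsupp.induction_linear with
    | zero => simp
    | add f g hf hg => simp [hf, hg]
    | single D₂ y =>
      induction x using Finsupp.induction_linear with
      | zero => simp
      | add f g hf hg => simp [hf, hg]
      | single D₁ x => simp only [Formal.comp_single, Diagram.comp_assoc, mul_assoc]

/-- The local relations of the skein category with parameter `q = t^{1/4}` (so `q ^ 2 = t^{1/2}`):
planar isotopy, the Kauffman skein relation at either kind of crossing, and the removal of a
contractible loop. -/
inductive SkeinRel (q : ℂ) : {a b : ℕ} → Formal a b → Formal a b → Prop
  | isotopy {a b : ℕ} {D D' : Diagram a b} (h : Move D D') :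
      SkeinRel q (Finsupp.single D 1) (Finsupp.single D' 1)
  | kauffman_pos (i r : ℕ) :
      SkeinRel q (Finsupp.single (box (a := i + 2 + r) (b := i + 2 + r) .pos i r rfl rfl) 1)
        (Finsupp.single ((box (a := i + r) (b := i + 2 + r) .cup i r rfl rfl).comp
            (box (a := i + 2 + r) .cap i r rfl rfl)) q
          + Finsupp.single (nil (i + 2 + r)) q⁻¹)
  | kauffman_neg (i r : ℕ) :
      SkeinRel q (Finsupp.single (box (a := i + 2 + r) (b := i + 2 + r) .neg i r rfl rfl) 1)
        (Finsupp.single ((box (a := i + r) (b := i + 2 + r) .cup i r rfl rfl).comp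
            (box (a := i + 2 + r) .cap i r rfl rfl)) q⁻¹
          + Finsupp.single (nil (i + 2 + r)) q)
  | loop (i r : ℕ) :
      SkeinRel q
        (Finsupp.single ((box (a := i + 2 + r) (b := i + r) .cap i r rfl rfl).comp
          (box (a := i + r) .cup i r rfl rfl)) 1)
        (Finsupp.single (nil (i + r)) (-(q ^ 2 + (q ^ 2)⁻¹)))

/-- The linear span of the local relations, applied anywhere inside a diagram. -/
def relations (q : ℂ) (a b : ℕ) : Submodule ℂ (Formal a b) :=
  Submodule.span ℂ {z | ∃ (c d : ℕ) (D₂ : Diagram d b) (D₁ : Diagram a c) (x y : Formal c d),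
    SkeinRel q x y ∧ z = Formal.comp (Finsupp.single D₂ 1)
      (Formal.comp (x - y) (Finsupp.single D₁ 1))}

theorem comp_mem_relations_right (q : ℂ) {a b c : ℕ} (z : Formal b c) {x : Formal a b}
    (hx : x ∈ relations q a b) : Formal.comp z x ∈ relations q a c := by
  induction z using Finsupp.induction_linear with
  | zero => simp
  | add f g hf hg => simpa using Submodule.add_mem _ hf hg
  | single D s =>
    have hs : (Finsupp.single D s : Formal b c) = s • Finsupp.single D 1 := by simp
    rw [hs, map_smul, LinearMap.smul_apply]
    refine Submodule.smul_mem _ _ ?_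
    induction hx using Submodule.span_induction with
    | mem x h =>
      obtain ⟨c', d', D₂, D₁, y, y', hr, rfl⟩ := h
      refine Submodule.subset_span ⟨c', d', D.comp D₂, D₁, y, y', hr, ?_⟩
      rw [← Formal.comp_assoc, Formal.comp_single, one_mul]
    | zero => simp
    | add x y _ _ hx hy => rw [map_add]; exact Submodule.add_mem _ hx hy
    | smul r x _ hx => rw [map_smul]; exact Submodule.smul_mem _ _ hx

theorem comp_mem_relations_left (q : ℂ) {a b c : ℕ} {z : Formal b c} (x : Formal a b)
    (hz : z ∈ relations q b c) : Formal.comp z x ∈ relations q a c := by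
  induction x using Finsupp.induction_linear with
  | zero => simp
  | add f g hf hg => rw [map_add]; exact Submodule.add_mem _ hf hg
  | single D s =>
    have hs : (Finsupp.single D s : Formal a b) = s • Finsupp.single D 1 := by simp
    rw [hs, map_smul]
    refine Submodule.smul_mem _ _ ?_
    induction hz using Submodule.span_induction with
    | mem x h =>
      obtain ⟨c', d', D₂, D₁, y, y', hr, rfl⟩ := h
      refine Submodule.subset_span ⟨c', d', D₂, D₁.comp D, y, y', hr, ?_⟩
      rw [Formal.comp_assoc, Formal.comp_assoc, Formal.comp_single, one_mul]
    | zero => simp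
    | add x y _ _ hx hy => rw [map_add]; exact Submodule.add_mem _ hx hy
    | smul r x _ hx => rw [map_smul]; exact Submodule.smul_mem _ _ hx

/-- The space of morphisms `a → b` of the skein category of the annulus. -/
def Hom (q : ℂ) (a b : ℕ) : Type := Formal a b ⧸ relations q a b

instance (q : ℂ) (a b : ℕ) : AddCommGroup (Hom q a b) :=
  inferInstanceAs (AddCommGroup (Formal a b ⧸ relations q a b))

instance (q : ℂ) (a b : ℕ) : Module ℂ (Hom q a b) :=
  inferInstanceAs (Module ℂ (Formal a b ⧸ relations q a b))

namespace Hom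

/-- The class of a formal linear combination of diagrams. -/
def ofFormal (q : ℂ) (a b : ℕ) : Formal a b →ₗ[ℂ] Hom q a b := (relations q a b).mkQ

/-- The skein class `[D]` of a diagram. -/
def mk (q : ℂ) {a b : ℕ} (D : Diagram a b) : Hom q a b := ofFormal q a b (Finsupp.single D 1)

theorem ofFormal_surjective (q : ℂ) (a b : ℕ) : Function.Surjective (ofFormal q a b) :=
  Submodule.mkQ_surjective _

/-- Composition of morphisms, `comp g f = g ∘ f`. -/
def comp {q : ℂ} {a b c : ℕ} : Hom q b c →ₗ[ℂ] Hom q a b →ₗ[ℂ] Hom q a c :=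
  (relations q b c).liftQ
    { toFun := fun z => (relations q a b).mapQ (relations q a c) (Formal.comp z)
        (fun _ hx => comp_mem_relations_right q z hx)
      map_add' := fun z z' => by
        refine Submodule.linearMap_qext _ (LinearMap.ext fun x => ?_)
        exact congrArg (relations q a c).mkQ (LinearMap.map_add₂ Formal.comp z z' x)
      map_smul' := fun r z => by
        refine Submodule.linearMap_qext _ (LinearMap.ext fun x => ?_)
        exact congrArg (relations q a c).mkQ (LinearMap.map_smul₂ Formal.comp r z x) }
    (fun z hz => by
      rw [LinearMap.mem_ker]
      apply Submodule.linearMap_qext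
      refine LinearMap.ext fun x => ?_
      exact (Submodule.Quotient.mk_eq_zero _).2 (comp_mem_relations_left q x hz))

theorem comp_ofFormal {q : ℂ} {a b c : ℕ} (z : Formal b c) (x : Formal a b) :
    comp (ofFormal q b c z) (ofFormal q a b x) = ofFormal q a c (Formal.comp z x) := rfl

theorem comp_assoc {q : ℂ} {a b c d : ℕ} (h : Hom q c d) (g : Hom q b c) (f : Hom q a b) :
    comp (comp h g) f = comp h (comp g f) := by
  obtain ⟨z, rfl⟩ := ofFormal_surjective q c d h
  obtain ⟨y, rfl⟩ := ofFormal_surjective q b c g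
  obtain ⟨x, rfl⟩ := ofFormal_surjective q a b f
  simp only [comp_ofFormal, Formal.comp_assoc]

theorem id_comp {q : ℂ} {a b : ℕ} (f : Hom q a b) : comp (mk q (nil b)) f = f := by
  obtain ⟨x, rfl⟩ := ofFormal_surjective q a b f
  rw [mk, comp_ofFormal]
  congr 1
  induction x using Finsupp.induction_linear with
  | zero => simp
  | add f g hf hg => rw [map_add, hf, hg]
  | single D s => rw [Formal.comp_single, one_mul]; rfl

theorem comp_id {q : ℂ} {a b : ℕ} (f : Hom q a b) : comp f (mk q (nil a)) = f := by
  obtain ⟨x, rfl⟩ := ofFormal_surjective q a b f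
  rw [mk, comp_ofFormal]
  congr 1
  induction x using Finsupp.induction_linear with
  | zero => simp
  | add f g hf hg => rw [map_add, LinearMap.add_apply, hf, hg]
  | single D s => rw [Formal.comp_single, mul_one, Diagram.comp_nil]

end Hom

/-- The extended affine Temperley-Lieb algebra `TL_n`, realized as the endomorphism algebra of the
object `n` of the skein category of the annulus. -/
def TL (q : ℂ) (n : ℕ) : Type := Hom q n n

instance (q : ℂ) (n : ℕ) : AddCommGroup (TL q n) := inferInstanceAs (AddCommGroup (Hom q n n))

instance (q : ℂ) (n : ℕ) : Module ℂ (TL q n) := inferInstanceAs (Module ℂ (Hom q n n))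

instance (q : ℂ) (n : ℕ) : Ring (TL q n) :=
  { (inferInstance : AddCommGroup (TL q n)) with
    mul := fun g f => Hom.comp (q := q) (a := n) (b := n) (c := n) g f
    one := Hom.mk q (nil n)
    left_distrib := fun h g f => map_add (Hom.comp (q := q) (a := n) (b := n) (c := n) h) g f
    right_distrib := fun h g f => LinearMap.map_add₂ Hom.comp h g f
    zero_mul := fun f => LinearMap.map_zero₂ Hom.comp f
    mul_zero := fun f => map_zero (Hom.comp (q := q) (a := n) (b := n) (c := n) f)
    mul_assoc := fun h g f => Hom.comp_assoc h g f
    one_mul := fun f => Hom.id_comp f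
    mul_one := fun f => Hom.comp_id f }

instance (q : ℂ) (n : ℕ) : Algebra ℂ (TL q n) :=
  Algebra.ofModule
    (fun r g f => LinearMap.map_smul₂ (Hom.comp (q := q) (a := n) (b := n) (c := n)) r g f)
    (fun r g f => map_smul (Hom.comp (q := q) (a := n) (b := n) (c := n) g) r f)

/-- The left `TL_b`-module structure on `Hom(a, b)` by composition. -/
instance (q : ℂ) (a b : ℕ) : Module (TL q b) (Hom q a b) where
  smul g f := Hom.comp (q := q) (a := a) (b := b) (c := b) g f
  one_smul f := Hom.id_comp f
  mul_smul h g f := Hom.comp_assoc h g f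
  smul_zero g := map_zero (Hom.comp (q := q) (a := a) (b := b) (c := b) g)
  smul_add g f f' := map_add (Hom.comp (q := q) (a := a) (b := b) (c := b) g) f f'
  add_smul g g' f := LinearMap.map_add₂ Hom.comp g g' f
  zero_smul f := LinearMap.map_zero₂ Hom.comp f

instance (q : ℂ) (a b : ℕ) : IsScalarTower ℂ (TL q b) (Hom q a b) where
  smul_assoc r g f :=
    LinearMap.map_smul₂ (Hom.comp (q := q) (a := a) (b := b) (c := b)) r g f

/-- The skein class of an `(n, n)`-tangle diagram as an element of `TL_n`. -/
def TL.mk (q : ℂ) {n : ℕ} (D : Diagram n n) : TL q n := Hom.mk q D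

/-! ### The modules of the link pattern tower -/

/-- The noncontractible loop `X` on the annulus: a cup, of which one leg is rotated through the
seam before both are joined again. -/
def loopX (q : ℂ) : Hom q 0 0 :=
  Hom.mk q ((box (a := 2) .cap 0 0 rfl rfl).comp ((rot 2).comp (box (a := 0) .cup 0 0 rfl rfl)))

/-- The generator `ρ` of `TL_1`, the strand winding once counterclockwise. -/
def rho (q : ℂ) : Hom q 1 1 := Hom.mk q (rot 1)

/-- `V_n(u) = Hom(0, n) ⊗_{ℂ[X]} ℂ` with `X` acting on `ℂ` by `u`, for even `n`: the quotient of
`Hom(0, n)` by all `Y ∘ X - u Y`. -/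
abbrev VEven (q u : ℂ) (n : ℕ) : Type :=
  Hom q 0 n ⧸ Submodule.span (TL q n)
    {z : Hom q 0 n | ∃ Y : Hom q 0 n, z = Hom.comp Y (loopX q) - u • Y}

/-- `V_n(v) = Hom(1, n) ⊗_{ℂ[ρ, ρ⁻¹]} ℂ` with `ρ` acting on `ℂ` by `v ≠ 0`, for odd `n`: the
quotient of `Hom(1, n)` by all `Z ∘ ρ - v Z`. -/
abbrev VOdd (q v : ℂ) (n : ℕ) : Type :=
  Hom q 1 n ⧸ Submodule.span (TL q n)
    {z : Hom q 1 n | ∃ Z : Hom q 1 n, z = Hom.comp Z (rho q) - v • Z}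

/-! ### Fusion -/

/-- The fusion product of a left `TL_n`-module `M₁` and a left `TL_m`-module `M₂`: the module
induced from `M₁ ⊗ M₂` along the algebra map `ε : TL_n ⊗ TL_m → TL_{n+m}`,
`[D] ⊗ [D'] ↦ [D ∗ D']`.  Since the classes `[D] ⊗ [D']` span `TL_n ⊗ TL_m`, it is the quotient of
`TL_{n+m} ⊗ (M₁ ⊗ M₂)` by the balancing relations at these elements. -/
abbrev Fusion (q : ℂ) (n m : ℕ) (M₁ M₂ : Type*)
    [AddCommGroup M₁] [Module ℂ M₁] [Module (TL q n) M₁] [IsScalarTower ℂ (TL q n) M₁]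
    [AddCommGroup M₂] [Module ℂ M₂] [Module (TL q m) M₂] [IsScalarTower ℂ (TL q m) M₂] : Type _ :=
  (TL q (n + m) ⊗[ℂ] (M₁ ⊗[ℂ] M₂)) ⧸ Submodule.span (TL q (n + m))
    {z : TL q (n + m) ⊗[ℂ] (M₁ ⊗[ℂ] M₂) |
      ∃ (Z : TL q (n + m)) (D : Diagram n n) (D' : Diagram m m) (x : M₁) (y : M₂),
        z = (Z * TL.mk q (D.star D')) ⊗ₜ[ℂ] (x ⊗ₜ[ℂ] y)
          - Z ⊗ₜ[ℂ] ((TL.mk q D • x) ⊗ₜ[ℂ] (TL.mk q D' • y))}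

end AnnularSkein

end

noncomputable section

namespace AnnularSkein

open Diagram

-- Write q for t^{1/4}. A linear map out of the fusion product is obtained from a bilinear map β
-- with β(Dx, D'y) = (D ∗ D') β(x, y) (`exists_fusion_lift`). Here the factors are quotients of
-- Hom(a, n) and Hom(1, 1), and the target is a quotient of Hom(c, n + 1). A single vector w in
-- Hom(c, a + 1) therefore suggests β(Y, Z) = (Y ∗ Z) ∘ w. Three things have to be checked, and
-- `exists_surjective_fusion_map` reduces the theorem to the last two.
--
-- (1) Equivariance: the operations Y ↦ Y ∗ Id₁ and Z ↦ Id ∗ Z must be well defined functors on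
-- skein classes, and their images must commute (`interchange`). The essential ingredient is that a
-- strand can be swept across any piece of a diagram (`sweep_pc`).
--
-- (2) Descent to the quotients: modulo the relations of the target, w has to be a simultaneous
-- eigenvector of x ∗ Id₁, where x is X or ρ, and of Id ∗ ρ, with the prescribed eigenvalues.
--
-- (3) Surjectivity: some Y ∗ Id₁ built from cups has a left inverse
-- (`exists_left_inverse_starHom`), so it is enough that w itself can be capped off to a nonzero
-- multiple of the identity.
--
-- In the first map w is the identity of one strand. Resolving the one crossing of X ∗ Id₁ gives qρ
-- + q⁻¹ρ⁻¹ (`starHom_loopX`), which acts on V(v) by u. In the second map w is a combination of the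
-- two cups in Hom(0, 2), with eigenvalues v and v⁻¹ modulo X = u. Capping w gives q(v² - q²) modulo
-- X = u (`cap_fusionVector`), which is nonzero exactly under the assumption v² ≠ t^{1/2}.

local infixr:80 " ⊙ " => Hom.comp

/-! ### Skein classes of diagrams -/

namespace Hom

variable {q : ℂ}

theorem mk_comp {a b c : ℕ} (D' : Diagram b c) (D : Diagram a b) :
    mk q (D'.comp D) = mk q D' ⊙ mk q D := by
  rw [mk, mk, mk, comp_ofFormal, Formal.comp_single, one_mul]

theorem ofFormal_single {a b : ℕ} (D : Diagram a b) (x : ℂ) :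
    ofFormal q a b (Finsupp.single D x) = x • mk q D := by
  rw [mk, ← map_smul, Finsupp.smul_single, smul_eq_mul, mul_one]

theorem ofFormal_eq_of_skeinRel {a b : ℕ} {x y : Formal a b} (h : SkeinRel q x y) :
    ofFormal q a b x = ofFormal q a b y := by
  rw [← sub_eq_zero, ← map_sub]
  refine (Submodule.Quotient.mk_eq_zero _).2 (Submodule.subset_span
    ⟨a, b, nil b, nil a, x, y, h, ?_⟩)
  generalize x - y = z
  induction z using Finsupp.induction_linear with
  | zero => simp
  | add f g hf hg =>
    rw [map_add, LinearMap.add_apply, map_add, ← hf, ← hg]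
  | single D s =>
    rw [Formal.comp_single, Formal.comp_single, Diagram.comp_nil, one_mul, mul_one]; rfl

theorem mk_eq_of_move {a b : ℕ} {D D' : Diagram a b} (h : Move D D') : mk q D = mk q D' :=
  ofFormal_eq_of_skeinRel (.isotopy h)

theorem induction_mk {a b : ℕ} {p : Hom q a b → Prop} (x : Hom q a b) (h0 : p 0)
    (hadd : ∀ x y, p x → p y → p (x + y)) (hsmul : ∀ (r : ℂ) x, p x → p (r • x))
    (hmk : ∀ D, p (mk q D)) : p x := by
  obtain ⟨z, rfl⟩ := ofFormal_surjective q a b x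
  induction z using Finsupp.induction_linear with
  | zero => simpa using h0
  | add f g hf hg => rw [map_add]; exact hadd _ _ hf hg
  | single D s => rw [ofFormal_single]; exact hsmul _ _ (hmk D)

end Hom

/-- The identity morphism. -/
def idm (q : ℂ) (n : ℕ) : Hom q n n := Hom.mk q (nil n)

/-- The class of a local piece at place `i`, and `0` if the sizes do not fit. -/
def pc (q : ℂ) (e : Piece) (i a b : ℕ) : Hom q a b :=
  if h : i + e.src ≤ a ∧ b + e.src = a + e.tgt then
    Hom.mk q (box e i (a - (i + e.src)) (by omega) (by omega))
  else 0

/-- The class of the rotation. -/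
def rt (q : ℂ) (n : ℕ) : Hom q n n := Hom.mk q (rot n)

/-- The class of the clockwise rotation. -/
def rti (q : ℂ) (n : ℕ) : Hom q n n := Hom.mk q (rotInv n)

/-! ### Calculus of pieces, rotations and crossings -/

section calculus

variable {q : ℂ}

/-- Passes from `box`, whose sizes are tied to `r` by proofs, to `pc`, whose sizes are free indices.
Equalities of places then reduce to `omega` under `congr`, with no casts between Hom spaces. -/
theorem mk_box {a b : ℕ} (e : Piece) (i r : ℕ) (ha : a = i + e.src + r) (hb : b = i + e.tgt + r) :
    Hom.mk q (box e i r ha hb) = pc q e i a b := by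
  rw [pc, dif_pos (by omega)]
  obtain rfl : r = a - (i + e.src) := by omega
  rfl

theorem mk_nil (n : ℕ) : Hom.mk q (nil n) = idm q n := rfl
theorem mk_rot (n : ℕ) : Hom.mk q (rot n) = rt q n := rfl
theorem mk_rotInv (n : ℕ) : Hom.mk q (rotInv n) = rti q n := rfl
theorem idm_comp {a b : ℕ} (f : Hom q a b) : idm q b ⊙ f = f := Hom.id_comp f
theorem comp_idm {a b : ℕ} (f : Hom q a b) : f ⊙ idm q a = f := Hom.comp_id f

theorem add_comp {a b c : ℕ} (g g' : Hom q b c) (f : Hom q a b) :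
    (g + g') ⊙ f = g ⊙ f + g' ⊙ f := LinearMap.map_add₂ _ _ _ _
theorem smul_comp {a b c : ℕ} (r : ℂ) (g : Hom q b c) (f : Hom q a b) :
    (r • g) ⊙ f = r • (g ⊙ f) := LinearMap.map_smul₂ _ _ _ _
theorem comp_add {a b c : ℕ} (g : Hom q b c) (f f' : Hom q a b) :
    g ⊙ (f + f') = g ⊙ f + g ⊙ f' := map_add _ _ _
theorem comp_smul {a b c : ℕ} (r : ℂ) (g : Hom q b c) (f : Hom q a b) :
    g ⊙ (r • f) = r • (g ⊙ f) := map_smul _ _ _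

/-- An equation between two-fold composites may be applied inside a longer composite. -/
theorem assoc_of_eq {a b b' c d : ℕ} {g : Hom q b c} {f : Hom q a b} {g' : Hom q b' c}
    {f' : Hom q a b'} (h : g ⊙ f = g' ⊙ f') (x : Hom q d a) : g ⊙ f ⊙ x = g' ⊙ f' ⊙ x := by
  rw [← Hom.comp_assoc, h, Hom.comp_assoc]

theorem assoc_of_eq_one {a b c d : ℕ} {g : Hom q b c} {f : Hom q a b} {k : Hom q a c}
    (h : g ⊙ f = k) (x : Hom q d a) : g ⊙ f ⊙ x = k ⊙ x := by
  rw [← Hom.comp_assoc, h]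

/-- Pieces at disjoint places may be moved past each other. -/
theorem pc_interchange (e e' : Piece) {i i' a b c d : ℕ} (hi : i + e.src ≤ i')
    (ha : i' + e'.src ≤ a) (hb : b + e'.src = a + e'.tgt) (hc : c + e.src = a + e.tgt)
    (hd : d + e.src = b + e.tgt) :
    pc q e i b d ⊙ pc q e' i' a b = pc q e' (i' - e.src + e.tgt) c d ⊙ pc q e i a c := by
  obtain ⟨j, rfl⟩ := Nat.exists_eq_add_of_le hi
  obtain ⟨r, rfl⟩ := Nat.exists_eq_add_of_le ha
  have h := Hom.mk_eq_of_move (q := q) (Move.interchange e e' i j r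
    (a := i + e.src + j + e'.src + r) (b := b) (c := c) (d := d) rfl (by omega) (by omega) (by omega))
  simp only [Hom.mk_comp, mk_box] at h
  rw [h]; congr 3; omega

theorem rt_pc (e : Piece) {i a b : ℕ} (ha : i + e.src + 1 ≤ a) (hb : b + e.src = a + e.tgt) :
    rt q b ⊙ pc q e i a b = pc q e (i + 1) a b ⊙ rt q a := by
  have h := Hom.mk_eq_of_move (q := q) (Move.rot_box e i (a - (i + e.src + 1))
    (a := a) (b := b) (by omega) (by omega))
  simpa only [Hom.mk_comp, mk_box, mk_rot] using h

theorem rt_rti (n : ℕ) : rt q n ⊙ rti q n = idm q n := by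
  simpa only [Hom.mk_comp, mk_rot, mk_rotInv, mk_nil] using
    Hom.mk_eq_of_move (q := q) (Move.rot_rotInv n)

theorem rti_rt (n : ℕ) : rti q n ⊙ rt q n = idm q n := by
  simpa only [Hom.mk_comp, mk_rot, mk_rotInv, mk_nil] using
    Hom.mk_eq_of_move (q := q) (Move.rotInv_rot n)

theorem rotPow_pc (e : Piece) {i a b : ℕ} (ha : a = i + e.src) (hb : b = i + e.tgt) :
    Hom.mk q (rotPow b e.tgt) ⊙ pc q e i a b = pc q e 0 a b ⊙ Hom.mk q (rotPow a e.src) := by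
  have h := Hom.mk_eq_of_move (q := q) (Move.rot_wrap e i ha hb)
  rwa [Hom.mk_comp, Hom.mk_comp, mk_box, mk_box] at h

theorem mk_rotPow_two (n : ℕ) : Hom.mk q (rotPow n 2) = rt q n ⊙ rt q n := by
  rw [rotPow, rotPow, rotPow, Hom.mk_comp, Hom.mk_comp, mk_nil, mk_rot, comp_idm]

/-- Both legs of a cup in the last place pass through the seam together; on the inner side there is
nothing to rotate, since a cup has no inner endpoints. -/
theorem rt_rt_cup {i b : ℕ} (hb : b = i + 2) :
    rt q b ⊙ rt q b ⊙ pc q .cup i i b = pc q .cup 0 i b := by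
  have h := rotPow_pc (q := q) .cup (i := i) (a := i) (b := b) rfl hb
  rw [Piece.tgt, mk_rotPow_two, Hom.comp_assoc] at h
  exact h.trans (comp_idm _)

theorem cap_rt_rt {i a : ℕ} (ha : a = i + 2) :
    pc q .cap 0 a i ⊙ rt q a ⊙ rt q a = pc q .cap i a i := by
  have h := rotPow_pc (q := q) .cap (i := i) (a := a) (b := i) ha rfl
  rw [Piece.src, mk_rotPow_two] at h
  exact h.symm.trans (idm_comp _)

theorem kauffman_pos {i n : ℕ} (m : ℕ) (hn : n = m + 2) (hi : i ≤ m) :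
    pc q .pos i n n = q • (pc q .cup i m n ⊙ pc q .cap i n m) + q⁻¹ • idm q n := by
  obtain ⟨r, rfl⟩ := Nat.exists_eq_add_of_le hi
  obtain rfl : n = i + 2 + r := by omega
  have h := Hom.ofFormal_eq_of_skeinRel (SkeinRel.kauffman_pos (q := q) i r)
  simp only [map_add, Hom.ofFormal_single, one_smul, Hom.mk_comp] at h
  rwa [← mk_box (a := i + 2 + r) (b := i + 2 + r) .pos i r rfl rfl,
    ← mk_box (a := i + r) (b := i + 2 + r) .cup i r rfl rfl,
    ← mk_box (a := i + 2 + r) (b := i + r) .cap i r rfl rfl]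

theorem kauffman_neg {i n : ℕ} (m : ℕ) (hn : n = m + 2) (hi : i ≤ m) :
    pc q .neg i n n = q⁻¹ • (pc q .cup i m n ⊙ pc q .cap i n m) + q • idm q n := by
  obtain ⟨r, rfl⟩ := Nat.exists_eq_add_of_le hi
  obtain rfl : n = i + 2 + r := by omega
  have h := Hom.ofFormal_eq_of_skeinRel (SkeinRel.kauffman_neg (q := q) i r)
  simp only [map_add, Hom.ofFormal_single, one_smul, Hom.mk_comp] at h
  rwa [← mk_box (a := i + 2 + r) (b := i + 2 + r) .neg i r rfl rfl,
    ← mk_box (a := i + r) (b := i + 2 + r) .cup i r rfl rfl,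
    ← mk_box (a := i + 2 + r) (b := i + r) .cap i r rfl rfl]

theorem cap_cup {i m n : ℕ} (hn : n = m + 2) (hi : i ≤ m) :
    pc q .cap i n m ⊙ pc q .cup i m n = (-(q ^ 2 + (q ^ 2)⁻¹)) • idm q m := by
  obtain ⟨r, rfl⟩ := Nat.exists_eq_add_of_le hi
  obtain rfl : n = i + 2 + r := by omega
  have h := Hom.ofFormal_eq_of_skeinRel (SkeinRel.loop (q := q) i r)
  simp only [Hom.ofFormal_single, one_smul, Hom.mk_comp] at h
  rwa [← mk_box (a := i + r) (b := i + 2 + r) .cup i r rfl rfl,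
    ← mk_box (a := i + 2 + r) (b := i + r) .cap i r rfl rfl]

theorem cap_cup_succ {i m n : ℕ} (hn : n = m + 2) (hi : i + 1 ≤ m) :
    pc q .cap i n m ⊙ pc q .cup (i + 1) m n = idm q m := by
  obtain ⟨r, rfl⟩ := Nat.exists_eq_add_of_le hi
  obtain rfl : n = i + 2 + (r + 1) := by omega
  have h := Hom.mk_eq_of_move (q := q) (Move.zigzag_left i r)
  simp only [Hom.mk_comp, mk_box, mk_nil] at h
  exact h

theorem cap_succ_cup {i m n : ℕ} (hn : n = m + 2) (hi : i + 1 ≤ m) :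
    pc q .cap (i + 1) n m ⊙ pc q .cup i m n = idm q m := by
  obtain ⟨r, rfl⟩ := Nat.exists_eq_add_of_le hi
  obtain rfl : n = i + 1 + 2 + r := by omega
  have h := Hom.mk_eq_of_move (q := q) (Move.zigzag_right i r)
  simp only [Hom.mk_comp, mk_box, mk_nil] at h
  exact h

/-- The second Reidemeister move is a consequence of the skein relations. With E = cup ∘ cap, the
product (qE + q⁻¹)(q⁻¹E + q) is E² + (q² + q⁻²)E + 1, and the loop value makes E² cancel the middle
term. -/
theorem pos_neg (hq : q ≠ 0) {i n : ℕ} (hi : i + 2 ≤ n) :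
    pc q .pos i n n ⊙ pc q .neg i n n = idm q n := by
  obtain ⟨m, rfl⟩ : ∃ m, n = m + 2 := ⟨n - 2, by omega⟩
  rw [kauffman_pos m rfl (by omega), kauffman_neg m rfl (by omega)]
  simp only [add_comp, smul_comp, comp_add, comp_smul, idm_comp, comp_idm, Hom.comp_assoc]
  rw [assoc_of_eq_one (cap_cup rfl (by omega))]
  simp only [smul_comp, comp_smul, idm_comp]
  match_scalars
  · field_simp
    ring
  · field_simp

theorem neg_pos (hq : q ≠ 0) {i n : ℕ} (hi : i + 2 ≤ n) :
    pc q .neg i n n ⊙ pc q .pos i n n = idm q n := by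
  obtain ⟨m, rfl⟩ : ∃ m, n = m + 2 := ⟨n - 2, by omega⟩
  rw [kauffman_pos m rfl (by omega), kauffman_neg m rfl (by omega)]
  simp only [add_comp, smul_comp, comp_add, comp_smul, idm_comp, comp_idm, Hom.comp_assoc]
  rw [assoc_of_eq_one (cap_cup rfl (by omega))]
  simp only [smul_comp, comp_smul, idm_comp]
  match_scalars
  · field_simp
    ring
  · field_simp

/-- The opposite crossing. -/
def Piece.inv : Piece → Piece
  | .pos => .neg
  | .neg => .pos
  | .cup => .cup
  | .cap => .cap

/-- A piece that is a crossing. -/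
def Piece.IsCrossing (x : Piece) : Prop := x = .pos ∨ x = .neg

theorem Piece.isCrossing_pos : Piece.IsCrossing .pos := Or.inl rfl
theorem Piece.isCrossing_neg : Piece.IsCrossing .neg := Or.inr rfl

theorem Piece.IsCrossing.src {x : Piece} (hx : x.IsCrossing) : x.src = 2 := by
  rcases hx with rfl | rfl <;> rfl

theorem Piece.IsCrossing.tgt {x : Piece} (hx : x.IsCrossing) : x.tgt = 2 := by
  rcases hx with rfl | rfl <;> rfl

theorem inv_comp_crossing (hq : q ≠ 0) {x : Piece} (hx : x.IsCrossing) {i n : ℕ} (hi : i + 2 ≤ n) :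
    pc q x.inv i n n ⊙ pc q x i n n = idm q n := by
  rcases hx with rfl | rfl
  · exact neg_pos hq hi
  · exact pos_neg hq hi

theorem crossing_comp_inv (hq : q ≠ 0) {x : Piece} (hx : x.IsCrossing) {i n : ℕ} (hi : i + 2 ≤ n) :
    pc q x i n n ⊙ pc q x.inv i n n = idm q n := by
  rcases hx with rfl | rfl
  · exact pos_neg hq hi
  · exact neg_pos hq hi

theorem crossing_succ_cup {x : Piece} (hx : x.IsCrossing) {i m n : ℕ} (hn : n = m + 2)
    (hi : i + 1 ≤ m) :
    pc q x (i + 1) n n ⊙ pc q .cup i m n = pc q x.inv i n n ⊙ pc q .cup (i + 1) m n := by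
  obtain ⟨r, rfl⟩ := Nat.exists_eq_add_of_le hi
  obtain rfl : n = i + 3 + r := by omega
  rcases hx with rfl | rfl
  · have h := Hom.mk_eq_of_move (q := q) (Move.pos_cup i r)
    simp only [Hom.mk_comp, mk_box] at h
    exact h
  · have h := Hom.mk_eq_of_move (q := q) (Move.neg_cup i r)
    simp only [Hom.mk_comp, mk_box] at h
    exact h

theorem cap_crossing_succ {x : Piece} (hx : x.IsCrossing) {i m n : ℕ} (hn : n = m + 2)
    (hi : i + 1 ≤ m) :
    pc q .cap i n m ⊙ pc q x (i + 1) n n = pc q .cap (i + 1) n m ⊙ pc q x.inv i n n := by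
  obtain ⟨r, rfl⟩ := Nat.exists_eq_add_of_le hi
  obtain rfl : n = i + 3 + r := by omega
  rcases hx with rfl | rfl
  · have h := Hom.mk_eq_of_move (q := q) (Move.cap_pos i r)
    simp only [Hom.mk_comp, mk_box] at h
    exact h
  · have h := Hom.mk_eq_of_move (q := q) (Move.cap_neg i r)
    simp only [Hom.mk_comp, mk_box] at h
    exact h

theorem Piece.IsCrossing.inv {x : Piece} (hx : x.IsCrossing) : x.inv.IsCrossing := by
  rcases hx with rfl | rfl
  · exact Or.inr rfl
  · exact Or.inl rfl

theorem Piece.inv_inv (x : Piece) : x.inv.inv = x := by cases x <;> rfl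

/-- A cup slides to the right past a strand. -/
theorem crossing_crossing_succ_cup (hq : q ≠ 0) {x : Piece} (hx : x.IsCrossing) {i m n : ℕ}
    (hn : n = m + 2) (hi : i + 1 ≤ m) :
    pc q x i n n ⊙ pc q x (i + 1) n n ⊙ pc q .cup i m n = pc q .cup (i + 1) m n := by
  rw [crossing_succ_cup hx hn hi, assoc_of_eq_one (crossing_comp_inv hq hx (by omega)), idm_comp]

/-- A cup slides to the left past a strand. -/
theorem crossing_succ_crossing_cup (hq : q ≠ 0) {x : Piece} (hx : x.IsCrossing) {i m n : ℕ}
    (hn : n = m + 2) (hi : i + 1 ≤ m) :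
    pc q x (i + 1) n n ⊙ pc q x i n n ⊙ pc q .cup (i + 1) m n = pc q .cup i m n := by
  have h := crossing_succ_cup (q := q) hx.inv hn hi
  rw [Piece.inv_inv] at h
  rw [← h, assoc_of_eq_one (crossing_comp_inv hq hx (by omega)), idm_comp]

theorem cap_crossing_succ_crossing (hq : q ≠ 0) {x : Piece} (hx : x.IsCrossing) {i m n : ℕ}
    (hn : n = m + 2) (hi : i + 1 ≤ m) :
    pc q .cap i n m ⊙ pc q x (i + 1) n n ⊙ pc q x i n n = pc q .cap (i + 1) n m := by
  rw [assoc_of_eq (cap_crossing_succ hx hn hi), inv_comp_crossing hq hx (by omega), comp_idm]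

theorem cap_succ_crossing_crossing_succ (hq : q ≠ 0) {x : Piece} (hx : x.IsCrossing) {i m n : ℕ}
    (hn : n = m + 2) (hi : i + 1 ≤ m) :
    pc q .cap (i + 1) n m ⊙ pc q x i n n ⊙ pc q x (i + 1) n n = pc q .cap i n m := by
  have h := cap_crossing_succ (q := q) hx.inv hn hi
  rw [Piece.inv_inv] at h
  rw [assoc_of_eq h.symm, inv_comp_crossing hq hx (by omega), comp_idm]

/-- A crossing commutes with a piece further to the right. -/
theorem crossing_pc_of_le {x : Piece} (hx : x.IsCrossing) (e : Piece) {i j a b : ℕ}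
    (hij : i + 2 ≤ j) (ha : j + e.src ≤ a) (hb : b + e.src = a + e.tgt) :
    pc q x i b b ⊙ pc q e j a b = pc q e j a b ⊙ pc q x i a a := by
  have h := pc_interchange (q := q) x e (i := i) (i' := j) (a := a) (b := b) (c := a) (d := b)
    (by rw [hx.src]; omega) ha hb (by rw [hx.src, hx.tgt]) (by rw [hx.src, hx.tgt])
  rw [h, hx.src, hx.tgt, Nat.sub_add_cancel (by omega)]

/-- A piece commutes with a crossing further to the right. -/
theorem crossing_pc_of_ge {x : Piece} (hx : x.IsCrossing) (e : Piece) {i j a b : ℕ}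
    (hij : j + e.src ≤ i) (ha : i + 2 ≤ a) (hb : b + e.src = a + e.tgt) :
    pc q x (i - e.src + e.tgt) b b ⊙ pc q e j a b = pc q e j a b ⊙ pc q x i a a :=
  (pc_interchange (q := q) e x (i := j) (i' := i) (a := a) (b := a) (c := b) (d := b)
    hij (by rw [hx.src]; omega) (by rw [hx.src, hx.tgt]) (by omega) (by omega)).symm

/-! ### Sweeping a strand past other strands and past pieces -/

/-- Strand `i` moves outwards to place `i + s` through crossings of type `x`. -/
def sweep (q : ℂ) (x : Piece) (n i : ℕ) : ℕ → Hom q n n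
  | 0 => idm q n
  | s + 1 => pc q x (i + s) n n ⊙ sweep q x n i s

/-- The inverse of `sweep`. -/
def sweepInv (q : ℂ) (x : Piece) (n i : ℕ) : ℕ → Hom q n n
  | 0 => idm q n
  | s + 1 => sweepInv q x n i s ⊙ pc q x.inv (i + s) n n

theorem mk_sweepPos (n i s : ℕ) (h : i + s + 1 ≤ n) :
    Hom.mk q (sweepPos n i s h) = sweep q .pos n i s := by
  induction s with
  | zero => rfl
  | succ s ih => rw [sweepPos, Hom.mk_comp, mk_box, ih]; rfl

theorem mk_sweepNeg (n i s : ℕ) (h : i + s + 1 ≤ n) :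
    Hom.mk q (sweepNeg n i s h) = sweep q .neg n i s := by
  induction s with
  | zero => rfl
  | succ s ih => rw [sweepNeg, Hom.mk_comp, mk_box, ih]; rfl

theorem mk_sweepPosInv (n i s : ℕ) (h : i + s + 1 ≤ n) :
    Hom.mk q (sweepPosInv n i s h) = sweepInv q .pos n i s := by
  induction s with
  | zero => rfl
  | succ s ih => rw [sweepPosInv, Hom.mk_comp, mk_box, ih]; rfl

theorem mk_sweepNegInv (n i s : ℕ) (h : i + s + 1 ≤ n) :
    Hom.mk q (sweepNegInv n i s h) = sweepInv q .neg n i s := by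
  induction s with
  | zero => rfl
  | succ s ih => rw [sweepNegInv, Hom.mk_comp, mk_box, ih]; rfl

theorem sweep_sweepInv (hq : q ≠ 0) {x : Piece} (hx : x.IsCrossing) {n i s : ℕ}
    (h : i + s + 1 ≤ n) : sweep q x n i s ⊙ sweepInv q x n i s = idm q n := by
  induction s with
  | zero => exact idm_comp _
  | succ s ih =>
    rw [sweep, sweepInv, Hom.comp_assoc, assoc_of_eq_one (ih (by omega)), idm_comp,
      crossing_comp_inv hq hx (by omega)]

theorem sweepInv_sweep (hq : q ≠ 0) {x : Piece} (hx : x.IsCrossing) {n i s : ℕ}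
    (h : i + s + 1 ≤ n) : sweepInv q x n i s ⊙ sweep q x n i s = idm q n := by
  induction s with
  | zero => exact idm_comp _
  | succ s ih =>
    rw [sweep, sweepInv, Hom.comp_assoc, assoc_of_eq_one (inv_comp_crossing hq hx (by omega)),
      idm_comp, ih (by omega)]

theorem rt_sweep {x : Piece} (hx : x.IsCrossing) {n i s : ℕ} (h : i + s + 2 ≤ n) :
    rt q n ⊙ sweep q x n i s = sweep q x n (i + 1) s ⊙ rt q n := by
  induction s with
  | zero => rw [sweep, sweep, idm_comp, comp_idm]
  | succ s ih =>
    rw [sweep, sweep, assoc_of_eq (rt_pc x (by rw [hx.src]; omega) (by rw [hx.src, hx.tgt])),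
      ih (by omega), Hom.comp_assoc]
    congr 3; omega

/-- A sweep commutes with a piece to the right of it. -/
theorem sweep_pc_of_le {x : Piece} (hx : x.IsCrossing) (e : Piece) {i s j a b : ℕ}
    (hj : i + s + 1 ≤ j) (ha : j + e.src ≤ a) (hb : b + e.src = a + e.tgt) :
    sweep q x b i s ⊙ pc q e j a b = pc q e j a b ⊙ sweep q x a i s := by
  induction s with
  | zero => rw [sweep, sweep, idm_comp, comp_idm]
  | succ s ih =>
    rw [sweep, sweep, Hom.comp_assoc, ih (by omega),
      assoc_of_eq (crossing_pc_of_le hx e (by omega) ha hb)]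

/-- A sweep commutes with a piece to the left of it. -/
theorem sweep_pc_of_ge {x : Piece} (hx : x.IsCrossing) (e : Piece) {i i' s j a b : ℕ}
    (hj : j + e.src ≤ i) (hi' : i' + e.src = i + e.tgt) (ha : i + s + 1 ≤ a)
    (hb : b + e.src = a + e.tgt) :
    sweep q x b i' s ⊙ pc q e j a b = pc q e j a b ⊙ sweep q x a i s := by
  induction s with
  | zero => rw [sweep, sweep, idm_comp, comp_idm]
  | succ s ih =>
    rw [sweep, sweep, Hom.comp_assoc, ih (by omega)]
    have h := crossing_pc_of_ge (q := q) hx e (i := i + s) (j := j) (a := a) (b := b)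
      (by omega) (by omega) hb
    rw [show i + s - e.src + e.tgt = i' + s by omega] at h
    rw [assoc_of_eq h]

/-- The first `j` crossings of the sweep take place to the left of the cup, the next two slide the
cup one place to the left, and the last `s` lie to its right, where they commute with it after a
shift by two places. -/
theorem sweep_cup (hq : q ≠ 0) {x : Piece} (hx : x.IsCrossing) {i j s m n : ℕ}
    (hn : n = m + 2) (h : i + j + s + 1 ≤ m) :
    sweep q x n i (j + s + 2) ⊙ pc q .cup (i + j + 1) m n =
      pc q .cup (i + j) m n ⊙ sweep q x m i (j + s) := by
  induction s with
  | zero =>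
    rw [sweep, sweep, Hom.comp_assoc, Hom.comp_assoc, add_zero,
      sweep_pc_of_le hx .cup (by omega) (by simp only [Piece.src]; omega)
        (by simp only [Piece.src, Piece.tgt]; omega)]
    rw [← Hom.comp_assoc, ← Hom.comp_assoc]
    congr 2
    rw [Hom.comp_assoc]
    exact crossing_succ_crossing_cup hq hx hn (by omega)
  | succ s ih =>
    rw [show j + (s + 1) + 2 = (j + s + 2) + 1 by omega, sweep, Hom.comp_assoc, ih (by omega),
      ← add_assoc j s 1, sweep]
    have h := crossing_pc_of_ge (q := q) hx .cup (i := i + (j + s)) (j := i + j) (a := m) (b := n)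
      (by simp only [Piece.src]; omega) (by omega) (by simp only [Piece.src, Piece.tgt]; omega)
    exact assoc_of_eq h _

theorem cap_sweep (hq : q ≠ 0) {x : Piece} (hx : x.IsCrossing) {i j s m n : ℕ}
    (hn : n = m + 2) (h : i + j + s + 1 ≤ m) :
    sweep q x m i (j + s) ⊙ pc q .cap (i + j + 1) n m =
      pc q .cap (i + j) n m ⊙ sweep q x n i (j + s + 2) := by
  induction s with
  | zero =>
    rw [add_zero, sweep_pc_of_le hx .cap (by omega) (by simp only [Piece.src]; omega)
        (by simp only [Piece.src, Piece.tgt]; omega), sweep, sweep,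
      ← cap_crossing_succ_crossing hq hx hn (by omega), Hom.comp_assoc, Hom.comp_assoc]
    rfl
  | succ s ih =>
    rw [← add_assoc j s 1, sweep, Hom.comp_assoc, ih (by omega),
      show j + s + 1 + 2 = (j + s + 2) + 1 by omega, sweep]
    have h := crossing_pc_of_ge (q := q) hx .cap (i := i + (j + s + 2)) (j := i + j) (a := n)
      (b := m) (by simp only [Piece.src]; omega) (by omega)
      (by simp only [Piece.src, Piece.tgt]; omega)
    exact assoc_of_eq h _

/-- A strand may be swept past any piece. -/
theorem sweep_pc (hq : q ≠ 0) {x : Piece} (hx : x.IsCrossing) (e : Piece) {i j s s' a b : ℕ}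
    (hj : j + e.src ≤ s) (hs : s' + e.src = s + e.tgt) (ha : i + s + 1 ≤ a)
    (hb : b + e.src = a + e.tgt) :
    sweep q x b i s' ⊙ pc q e (i + j + 1) a b = pc q e (i + j) a b ⊙ sweep q x a i s := by
  -- A crossing is a combination of cup ∘ cap and the identity, so it passes the sweep once cups and
  -- caps do. This takes the place of the third Reidemeister move.
  have crossing : ∀ (r r' : ℂ), j + 2 ≤ s → ∀ m, a = m + 2 →
      sweep q x a i s ⊙ (r • (pc q .cup (i + j + 1) m a ⊙ pc q .cap (i + j + 1) a m) +
        r' • idm q a) =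
      (r • (pc q .cup (i + j) m a ⊙ pc q .cap (i + j) a m) + r' • idm q a) ⊙ sweep q x a i s := by
    intro r r' hj m hm
    obtain ⟨t, rfl⟩ := Nat.exists_eq_add_of_le hj
    simp only [add_comp, smul_comp, comp_add, comp_smul, idm_comp, comp_idm, Hom.comp_assoc]
    rw [show j + 2 + t = j + t + 2 by omega, assoc_of_eq (sweep_cup hq hx hm (by omega)),
      cap_sweep hq hx hm (by omega)]
  cases e with
  | cup =>
    simp only [Piece.src, Piece.tgt] at *
    obtain ⟨t, rfl⟩ := Nat.exists_eq_add_of_le hj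
    obtain rfl : s' = j + t + 2 := by omega
    exact sweep_cup hq hx (by omega) (by omega)
  | cap =>
    simp only [Piece.src, Piece.tgt] at *
    obtain ⟨t, rfl⟩ := Nat.exists_eq_add_of_le hj
    obtain rfl : s' = j + t := by omega
    rw [show j + 2 + t = j + t + 2 by omega]
    exact cap_sweep hq hx (by omega) (by omega)
  | pos =>
    simp only [Piece.src, Piece.tgt] at *
    obtain rfl : s' = s := by omega
    obtain rfl : b = a := by omega
    rw [kauffman_pos (b - 2) (by omega) (by omega), kauffman_pos (b - 2) (by omega) (by omega)]
    exact crossing _ _ hj _ (by omega)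
  | neg =>
    simp only [Piece.src, Piece.tgt] at *
    obtain rfl : s' = s := by omega
    obtain rfl : b = a := by omega
    rw [kauffman_neg (b - 2) (by omega) (by omega), kauffman_neg (b - 2) (by omega) (by omega)]
    exact crossing _ _ hj _ (by omega)

/-- Two neighbouring sweeps, the outer crossing last. -/
theorem sweep_sweep_succ {x : Piece} (hx : x.IsCrossing) {n i s : ℕ} (h : i + s + 3 ≤ n) :
    sweep q x n i (s + 1) ⊙ sweep q x n (i + 1) (s + 1) =
      pc q x (i + s) n n ⊙ pc q x (i + s + 1) n n ⊙
        sweep q x n i s ⊙ sweep q x n (i + 1) s := by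
  rw [sweep, sweep, Hom.comp_assoc, ← Hom.comp_assoc (sweep q x n i s),
    show i + 1 + s = i + s + 1 by omega, sweep_pc_of_le hx x (by omega) (by rw [hx.src]; omega)
    (by rw [hx.src, hx.tgt]), Hom.comp_assoc]

/-- Both legs of a cup are carried across the same `s` strands. Regrouping the crossings so that the
two legs pass one strand at a time turns each pair into a slide of the cup by one place. -/
theorem sweep_sweep_cup (hq : q ≠ 0) {x : Piece} (hx : x.IsCrossing) {m n i s : ℕ}
    (hn : n = m + 2) (h : i + s ≤ m) :
    sweep q x n i s ⊙ sweep q x n (i + 1) s ⊙ pc q .cup i m n = pc q .cup (i + s) m n := by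
  induction s with
  | zero => rw [sweep, sweep, idm_comp, idm_comp, add_zero]
  | succ s ih =>
    rw [← Hom.comp_assoc, sweep_sweep_succ hx (by omega)]
    simp only [Hom.comp_assoc]
    rw [ih (by omega), crossing_crossing_succ_cup hq hx hn (by omega), add_assoc]

theorem cap_sweep_sweep (hq : q ≠ 0) {x : Piece} (hx : x.IsCrossing) {m n i s : ℕ}
    (hn : n = m + 2) (h : i + s ≤ m) :
    pc q .cap (i + s) n m ⊙ sweep q x n i s ⊙ sweep q x n (i + 1) s = pc q .cap i n m := by
  induction s with
  | zero => rw [sweep, sweep, idm_comp, comp_idm, add_zero]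
  | succ s ih =>
    rw [sweep_sweep_succ hx (by omega), ← ih (by omega), ← add_assoc,
      ← cap_succ_crossing_crossing_succ hq hx hn (by omega : i + s + 1 ≤ m)]
    simp only [Hom.comp_assoc]

end calculus

/-! ### Inserting strands is compatible with the skein relations -/

/-- A functor from annular tangle diagrams to the skein category which inserts `s` strands before
and `t` strands after the strands of a diagram. -/
structure StrandInsertion (q : ℂ) (s t : ℕ) where
  obj : ℕ → ℕ
  obj_eq : ∀ a, obj a = s + a + t
  map : ∀ {a b : ℕ}, Diagram a b → Hom q (obj a) (obj b)
  map_nil : ∀ a, map (nil a) = idm q (obj a)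
  map_comp : ∀ {a b c : ℕ} (D' : Diagram b c) (D : Diagram a b),
    map (D'.comp D) = map D' ⊙ map D
  map_box : ∀ {a b : ℕ} (e : Piece) (i r : ℕ) (ha : a = i + e.src + r) (hb : b = i + e.tgt + r),
    map (box e i r ha hb) = pc q e (s + i) (obj a) (obj b)
  rot_pc : ∀ {a b : ℕ} (e : Piece) (i : ℕ), i + e.src + 1 ≤ a → b + e.src = a + e.tgt →
    map (rot b) ⊙ pc q e (s + i) (obj a) (obj b) =
      pc q e (s + i + 1) (obj a) (obj b) ⊙ map (rot a)
  rot_rot_cup : ∀ i : ℕ, map (rot (i + 2)) ⊙ map (rot (i + 2)) ⊙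
    pc q .cup (s + i) (obj i) (obj (i + 2)) = pc q .cup s (obj i) (obj (i + 2))
  cap_rot_rot : ∀ i : ℕ, pc q .cap s (obj (i + 2)) (obj i) ⊙ map (rot (i + 2)) ⊙
    map (rot (i + 2)) = pc q .cap (s + i) (obj (i + 2)) (obj i)
  rot_rotInv : ∀ n, map (rot n) ⊙ map (rotInv n) = idm q (obj n)
  rotInv_rot : ∀ n, map (rotInv n) ⊙ map (rot n) = idm q (obj n)
  rot_zero : map (rot 0) = idm q (obj 0)

namespace StrandInsertion

variable {q : ℂ} {s t : ℕ} (F : StrandInsertion q s t)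

theorem rotPow_two (n : ℕ) : F.map (rotPow n 2) = F.map (rot n) ⊙ F.map (rot n) := by
  rw [rotPow, rotPow, rotPow, F.map_comp, F.map_comp, F.map_nil, comp_idm]

theorem rotPow_zero (n : ℕ) : F.map (rotPow n 0) = idm q (F.obj n) := F.map_nil n

/-- The double rotation carries cup ∘ cap at the last place to cup ∘ cap at the first. Hence
crossings wrap around the seam as soon as cups and caps do, and the structure needs no field for
them. -/
theorem rot_rot_kauffman (i : ℕ) (r r' : ℂ) :
    (F.map (rot (i + 2)) ⊙ F.map (rot (i + 2))) ⊙
      (r • (pc q .cup (s + i) (F.obj i) (F.obj (i + 2)) ⊙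
        pc q .cap (s + i) (F.obj (i + 2)) (F.obj i)) + r' • idm q (F.obj (i + 2))) =
    (r • (pc q .cup s (F.obj i) (F.obj (i + 2)) ⊙ pc q .cap s (F.obj (i + 2)) (F.obj i)) +
      r' • idm q (F.obj (i + 2))) ⊙ F.map (rot (i + 2)) ⊙ F.map (rot (i + 2)) := by
  simp only [add_comp, smul_comp, comp_add, comp_smul, idm_comp, comp_idm, Hom.comp_assoc]
  rw [F.cap_rot_rot, ← F.rot_rot_cup]
  simp only [Hom.comp_assoc]

theorem rotPow_pc (e : Piece) {i a b : ℕ} (ha : a = i + e.src) (hb : b = i + e.tgt) :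
    F.map (rotPow b e.tgt) ⊙ pc q e (s + i) (F.obj a) (F.obj b) =
      pc q e s (F.obj a) (F.obj b) ⊙ F.map (rotPow a e.src) := by
  have h0 := F.obj_eq i
  have h2 := F.obj_eq (i + 2)
  cases e with
  | cup =>
    obtain rfl : a = i := ha
    obtain rfl : b = a + 2 := hb
    rw [Piece.tgt, Piece.src, rotPow_two, rotPow_zero, comp_idm, Hom.comp_assoc]
    exact F.rot_rot_cup a
  | cap =>
    obtain rfl : b = i := hb
    obtain rfl : a = b + 2 := ha
    rw [Piece.tgt, Piece.src, rotPow_two, rotPow_zero, idm_comp]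
    exact (F.cap_rot_rot b).symm
  | pos =>
    obtain rfl : a = i + 2 := ha
    obtain rfl : b = i + 2 := hb
    rw [Piece.tgt, Piece.src, rotPow_two, kauffman_pos (F.obj i) (by omega) (by omega),
      kauffman_pos (F.obj i) (by omega) (by omega)]
    exact F.rot_rot_kauffman i _ _
  | neg =>
    obtain rfl : a = i + 2 := ha
    obtain rfl : b = i + 2 := hb
    rw [Piece.tgt, Piece.src, rotPow_two, kauffman_neg (F.obj i) (by omega) (by omega),
      kauffman_neg (F.obj i) (by omega) (by omega)]
    exact F.rot_rot_kauffman i _ _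

/-- A move without rotations is only shifted by `s` places and stays a move. Only the relations
involving the seam carry content; these are the fields of the structure together with `rotPow_pc`.
-/
theorem map_eq_of_move {a b : ℕ} {D D' : Diagram a b} (h : Move D D') : F.map D = F.map D' := by
  have ho := F.obj_eq
  cases h with
  | @interchange a b c d e e' i j r ha hb hc hd =>
    simp only [map_comp, map_box]
    rw [pc_interchange e e' (c := F.obj c)]
    · congr 3; omega
    all_goals (try simp only [ho]); omega
  | rot_box e i r ha hb =>
    simp only [map_comp, map_box]
    exact F.rot_pc e i (by omega) (by omega)
  | rot_wrap e i ha hb =>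
    rw [map_comp, map_comp, map_box, map_box]
    exact F.rotPow_pc e ha hb
  | rot_rotInv => rw [map_comp, map_nil]; exact F.rot_rotInv _
  | rotInv_rot => rw [map_comp, map_nil]; exact F.rotInv_rot _
  | rot_zero => rw [map_nil]; exact F.rot_zero
  | zigzag_left i r =>
    simp only [map_comp, map_box, map_nil]
    refine cap_cup_succ (i := s + i) ?_ ?_ <;> simp only [ho, Piece.src] <;> omega
  | zigzag_right i r =>
    simp only [map_comp, map_box, map_nil]
    refine cap_succ_cup (i := s + i) ?_ ?_ <;> simp only [ho, Piece.src] <;> omega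
  | cap_pos i r =>
    simp only [map_comp, map_box]
    refine cap_crossing_succ Piece.isCrossing_pos (i := s + i) ?_ ?_ <;> simp only [ho] <;> omega
  | cap_neg i r =>
    simp only [map_comp, map_box]
    refine cap_crossing_succ Piece.isCrossing_neg (i := s + i) ?_ ?_ <;> simp only [ho] <;> omega
  | pos_cup i r =>
    simp only [map_comp, map_box]
    refine crossing_succ_cup Piece.isCrossing_pos (i := s + i) ?_ ?_ <;> simp only [ho] <;> omega
  | neg_cup i r =>
    simp only [map_comp, map_box]
    refine crossing_succ_cup Piece.isCrossing_neg (i := s + i) ?_ ?_ <;> simp only [ho] <;> omega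

/-- The linear extension to formal combinations of diagrams. -/
def formal (a b : ℕ) : Formal a b →ₗ[ℂ] Hom q (F.obj a) (F.obj b) :=
  Finsupp.linearCombination ℂ (F.map (a := a) (b := b))

theorem formal_single {a b : ℕ} (D : Diagram a b) (x : ℂ) :
    F.formal a b (Finsupp.single D x) = x • F.map D := Finsupp.linearCombination_single _ _ _

theorem formal_comp {a b c : ℕ} (z : Formal b c) (x : Formal a b) :
    F.formal a c (Formal.comp z x) = F.formal b c z ⊙ F.formal a b x := by
  induction z using Finsupp.induction_linear with
  | zero => simp
  | add f g hf hg => simp only [map_add, LinearMap.add_apply, hf, hg]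
  | single D s =>
    induction x using Finsupp.induction_linear with
    | zero => simp
    | add f g hf hg => simp only [map_add, hf, hg]
    | single D' s' =>
      rw [Formal.comp_single, formal_single, formal_single, formal_single, F.map_comp, smul_comp,
        comp_smul, smul_smul]

theorem formal_eq_of_skeinRel {a b : ℕ} {x y : Formal a b} (h : SkeinRel q x y) :
    F.formal a b x = F.formal a b y := by
  have ho := F.obj_eq
  cases h with
  | isotopy h => rw [formal_single, formal_single, F.map_eq_of_move h]
  | kauffman_pos i r =>
    rw [map_add, formal_single, formal_single, formal_single, F.map_comp, one_smul, F.map_nil]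
    refine (F.map_box (a := i + 2 + r) (b := i + 2 + r) .pos i r rfl rfl).trans ?_
    rw [kauffman_pos (F.obj (i + r)) (by simp only [ho]; omega) (by simp only [ho]; omega)]
    congr 4
    · exact (F.map_box (a := i + r) (b := i + 2 + r) .cup i r rfl rfl).symm
    · exact (F.map_box (a := i + 2 + r) (b := i + r) .cap i r rfl rfl).symm
  | kauffman_neg i r =>
    rw [map_add, formal_single, formal_single, formal_single, F.map_comp, one_smul, F.map_nil]
    refine (F.map_box (a := i + 2 + r) (b := i + 2 + r) .neg i r rfl rfl).trans ?_
    rw [kauffman_neg (F.obj (i + r)) (by simp only [ho]; omega) (by simp only [ho]; omega)]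
    congr 4
    · exact (F.map_box (a := i + r) (b := i + 2 + r) .cup i r rfl rfl).symm
    · exact (F.map_box (a := i + 2 + r) (b := i + r) .cap i r rfl rfl).symm
  | loop i r =>
    rw [formal_single, formal_single, F.map_comp, one_smul, F.map_nil,
      ← cap_cup (i := s + i) (n := F.obj (i + 2 + r)) (by simp only [ho]; omega)
        (by simp only [ho]; omega)]
    congr 2
    · exact F.map_box (a := i + 2 + r) (b := i + r) .cap i r rfl rfl
    · exact F.map_box (a := i + r) (b := i + 2 + r) .cup i r rfl rfl

/-- The induced map on skein modules. -/
def hom (a b : ℕ) : Hom q a b →ₗ[ℂ] Hom q (F.obj a) (F.obj b) :=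
  (relations q a b).liftQ (F.formal a b) <| Submodule.span_le.2 <| by
    rintro _ ⟨c, d, D₂, D₁, x, y, h, rfl⟩
    rw [SetLike.mem_coe, LinearMap.mem_ker, formal_comp, formal_comp, map_sub,
      F.formal_eq_of_skeinRel h, sub_self, LinearMap.map_zero₂, map_zero]

theorem hom_mk {a b : ℕ} (D : Diagram a b) : F.hom a b (Hom.mk q D) = F.map D :=
  (F.formal_single D 1).trans (one_smul _ _)

theorem hom_comp {a b c : ℕ} (g : Hom q b c) (f : Hom q a b) :
    F.hom a c (g ⊙ f) = F.hom b c g ⊙ F.hom a b f := by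
  obtain ⟨z, rfl⟩ := Hom.ofFormal_surjective q b c g
  obtain ⟨x, rfl⟩ := Hom.ofFormal_surjective q a b f
  exact F.formal_comp z x

theorem hom_idm (a : ℕ) : F.hom a a (idm q a) = idm q (F.obj a) :=
  (F.hom_mk _).trans (F.map_nil a)

theorem hom_pc (e : Piece) {i a b : ℕ} (ha : i + e.src ≤ a) (hb : b + e.src = a + e.tgt) :
    F.hom a b (pc q e i a b) = pc q e (s + i) (F.obj a) (F.obj b) := by
  rw [pc, dif_pos ⟨ha, hb⟩, hom_mk, map_box]

end StrandInsertion

/-! ### The functors D ↦ D ∗ Id₁ and D ↦ Id_k ∗ D -/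

section star

variable {q : ℂ}

theorem mk_starId_comp (m : ℕ) {a b c : ℕ} (D' : Diagram b c) (D : Diagram a b) :
    Hom.mk q (starId m (D'.comp D)) = Hom.mk q (starId m D') ⊙ Hom.mk q (starId m D) := by
  induction D' with
  | nil => exact (idm_comp _).symm
  | cons s D' ih => rw [Diagram.comp, starId, Hom.mk_comp, ih, starId, Hom.mk_comp, Hom.comp_assoc]

theorem mk_idStar_comp (k : ℕ) {a b c : ℕ} (D' : Diagram b c) (D : Diagram a b) :
    Hom.mk q (idStar k (D'.comp D)) = Hom.mk q (idStar k D') ⊙ Hom.mk q (idStar k D) := by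
  induction D' with
  | nil => exact (idm_comp _).symm
  | cons s D' ih => rw [Diagram.comp, idStar, Hom.mk_comp, ih, idStar, Hom.mk_comp, Hom.comp_assoc]

theorem mk_starId_ofSlice (m : ℕ) {a b : ℕ} (s : Slice a b) :
    Hom.mk q (starId m (ofSlice s)) = Hom.mk q (s.starId m) := by
  rw [ofSlice, starId, starId, comp_nil]

theorem mk_idStar_ofSlice (k : ℕ) {a b : ℕ} (s : Slice a b) :
    Hom.mk q (idStar k (ofSlice s)) = Hom.mk q (s.idStar k) := by
  rw [ofSlice, idStar, idStar, comp_nil]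

theorem mk_starId_box (m : ℕ) {a b : ℕ} (e : Piece) (i r : ℕ) (ha : a = i + e.src + r)
    (hb : b = i + e.tgt + r) :
    Hom.mk q (starId m (box e i r ha hb)) = pc q e i (a + m) (b + m) := by
  rw [box, mk_starId_ofSlice, Slice.starId, mk_box]

theorem mk_idStar_box (k : ℕ) {a b : ℕ} (e : Piece) (i r : ℕ) (ha : a = i + e.src + r)
    (hb : b = i + e.tgt + r) :
    Hom.mk q (idStar k (box e i r ha hb)) = pc q e (k + i) (k + a) (k + b) := by
  rw [box, mk_idStar_ofSlice, Slice.idStar, mk_box]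

theorem mk_starId_rot_zero (m : ℕ) : Hom.mk q (starId m (rot 0)) = idm q (0 + m) := by
  rw [rot, mk_starId_ofSlice, Slice.starId, mk_nil]

theorem mk_idStar_rot_zero (k : ℕ) : Hom.mk q (idStar k (rot 0)) = idm q (k + 0) := by
  rw [rot, mk_idStar_ofSlice, Slice.idStar, mk_nil]

theorem mk_starId_rotInv_zero (m : ℕ) : Hom.mk q (starId m (rotInv 0)) = idm q (0 + m) := by
  rw [rotInv, mk_starId_ofSlice, Slice.starId, mk_nil]

theorem mk_idStar_rotInv_zero (k : ℕ) : Hom.mk q (idStar k (rotInv 0)) = idm q (k + 0) := by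
  rw [rotInv, mk_idStar_ofSlice, Slice.idStar, mk_nil]

theorem mk_starId_rot_succ (m n : ℕ) : Hom.mk q (starId m (rot (n + 1))) =
    rt q (n + 1 + m) ⊙ sweep q .neg (n + 1 + m) n m := by
  rw [rot, mk_starId_ofSlice, Slice.starId, Hom.mk_comp, mk_rot, mk_sweepNeg]

theorem mk_idStar_rot_succ (k n : ℕ) : Hom.mk q (idStar k (rot (n + 1))) =
    sweep q .pos (k + (n + 1)) 0 k ⊙ rt q (k + (n + 1)) := by
  rw [rot, mk_idStar_ofSlice, Slice.idStar, Hom.mk_comp, mk_rot, mk_sweepPos]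

theorem mk_starId_rotInv_succ (m n : ℕ) : Hom.mk q (starId m (rotInv (n + 1))) =
    sweepInv q .neg (n + 1 + m) n m ⊙ rti q (n + 1 + m) := by
  rw [rotInv, mk_starId_ofSlice, Slice.starId, Hom.mk_comp, mk_rotInv, mk_sweepNegInv]

theorem mk_idStar_rotInv_succ (k n : ℕ) : Hom.mk q (idStar k (rotInv (n + 1))) =
    rti q (k + (n + 1)) ⊙ sweepInv q .pos (k + (n + 1)) 0 k := by
  rw [rotInv, mk_idStar_ofSlice, Slice.idStar, Hom.mk_comp, mk_rotInv, mk_sweepPosInv]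

theorem starId_rot_rotInv (hq : q ≠ 0) (m n : ℕ) :
    Hom.mk q (starId m (rot n)) ⊙ Hom.mk q (starId m (rotInv n)) = idm q (n + m) := by
  cases n with
  | zero => rw [mk_starId_rot_zero, mk_starId_rotInv_zero, idm_comp]
  | succ n =>
    rw [mk_starId_rot_succ, mk_starId_rotInv_succ, Hom.comp_assoc, ← Hom.comp_assoc (sweep _ _ _ _ _),
      sweep_sweepInv hq Piece.isCrossing_neg (by omega), idm_comp, rt_rti]

theorem starId_rotInv_rot (hq : q ≠ 0) (m n : ℕ) :
    Hom.mk q (starId m (rotInv n)) ⊙ Hom.mk q (starId m (rot n)) = idm q (n + m) := by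
  cases n with
  | zero => rw [mk_starId_rot_zero, mk_starId_rotInv_zero, idm_comp]
  | succ n =>
    rw [mk_starId_rot_succ, mk_starId_rotInv_succ, Hom.comp_assoc, assoc_of_eq_one (rti_rt _),
      idm_comp, sweepInv_sweep hq Piece.isCrossing_neg (by omega)]

theorem idStar_rot_rotInv (hq : q ≠ 0) (k n : ℕ) :
    Hom.mk q (idStar k (rot n)) ⊙ Hom.mk q (idStar k (rotInv n)) = idm q (k + n) := by
  cases n with
  | zero => rw [mk_idStar_rot_zero, mk_idStar_rotInv_zero, idm_comp]
  | succ n =>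
    rw [mk_idStar_rot_succ, mk_idStar_rotInv_succ, Hom.comp_assoc, assoc_of_eq_one (rt_rti _),
      idm_comp, sweep_sweepInv hq Piece.isCrossing_pos (by omega)]

theorem idStar_rotInv_rot (hq : q ≠ 0) (k n : ℕ) :
    Hom.mk q (idStar k (rotInv n)) ⊙ Hom.mk q (idStar k (rot n)) = idm q (k + n) := by
  cases n with
  | zero => rw [mk_idStar_rot_zero, mk_idStar_rotInv_zero, idm_comp]
  | succ n =>
    rw [mk_idStar_rot_succ, mk_idStar_rotInv_succ, Hom.comp_assoc,
      assoc_of_eq_one (sweepInv_sweep hq Piece.isCrossing_pos (by omega)), idm_comp, rti_rt]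

theorem starId_rot_pc (m : ℕ) {a b : ℕ} (e : Piece) (i : ℕ) (ha : i + e.src + 1 ≤ a)
    (hb : b + e.src = a + e.tgt) :
    Hom.mk q (starId m (rot b)) ⊙ pc q e i (a + m) (b + m) =
      pc q e (i + 1) (a + m) (b + m) ⊙ Hom.mk q (starId m (rot a)) := by
  obtain ⟨a, rfl⟩ : ∃ a', a = a' + 1 := ⟨a - 1, by omega⟩
  obtain ⟨b, rfl⟩ : ∃ b', b = b' + 1 := ⟨b - 1, by omega⟩
  rw [mk_starId_rot_succ, mk_starId_rot_succ, Hom.comp_assoc,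
    sweep_pc_of_ge Piece.isCrossing_neg e (i := a) (by omega) (by omega) (by omega) (by omega),
    assoc_of_eq (rt_pc e (by omega) (by omega))]

theorem idStar_rot_pc (k : ℕ) {a b : ℕ} (e : Piece) (i : ℕ) (ha : i + e.src + 1 ≤ a)
    (hb : b + e.src = a + e.tgt) :
    Hom.mk q (idStar k (rot b)) ⊙ pc q e (k + i) (k + a) (k + b) =
      pc q e (k + i + 1) (k + a) (k + b) ⊙ Hom.mk q (idStar k (rot a)) := by
  obtain ⟨a, rfl⟩ : ∃ a', a = a' + 1 := ⟨a - 1, by omega⟩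
  obtain ⟨b, rfl⟩ : ∃ b', b = b' + 1 := ⟨b - 1, by omega⟩
  rw [mk_idStar_rot_succ, mk_idStar_rot_succ, Hom.comp_assoc, rt_pc e (by omega) (by omega),
    assoc_of_eq (sweep_pc_of_le Piece.isCrossing_pos e (by omega) (by omega) (by omega))]

theorem sweep_one (x : Piece) (n i : ℕ) : sweep q x n i 1 = pc q x i n n := by
  rw [sweep, sweep, comp_idm, add_zero]

theorem rt_crossing {x : Piece} (hx : x.IsCrossing) {i n : ℕ} (h : i + 3 ≤ n) :
    rt q n ⊙ pc q x i n n = pc q x (i + 1) n n ⊙ rt q n :=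
  rt_pc x (by rw [hx.src]; omega) (by rw [hx.src, hx.tgt])

/-- The functor inserting one strand underneath a diagram, just before the seam. -/
def starFunctor (hq : q ≠ 0) : StrandInsertion q 0 1 where
  obj a := a + 1
  obj_eq a := by omega
  map D := Hom.mk q (starId 1 D)
  map_nil a := rfl
  map_comp := mk_starId_comp 1
  map_box e i r ha hb := by rw [mk_starId_box, zero_add]
  rot_pc e i ha hb := by rw [zero_add]; exact starId_rot_pc 1 e i ha hb
  rot_rot_cup i := by
    -- Collecting both rotations on the outside leaves two crossings which slide the cup over the
    -- inserted strand, from place `i` to the last place `i + 1`; from there it wraps around the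
    -- seam.
    rw [mk_starId_rot_succ, sweep_one, zero_add, Hom.comp_assoc, Hom.comp_assoc,
      ← assoc_of_eq (rt_crossing Piece.isCrossing_neg (by omega)),
      crossing_crossing_succ_cup hq Piece.isCrossing_neg (by omega) (by omega)]
    exact rt_rt_cup (by omega)
  cap_rot_rot i := by
    rw [mk_starId_rot_succ, sweep_one, zero_add, Hom.comp_assoc,
      ← assoc_of_eq (rt_crossing Piece.isCrossing_neg (by omega)),
      ← cap_succ_crossing_crossing_succ hq Piece.isCrossing_neg (by omega : i + 1 + 2 = i + 1 + 2)
        (le_refl _), ← cap_rt_rt (i := i + 1) (by omega)]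
    simp only [Hom.comp_assoc]
  rot_rotInv := starId_rot_rotInv hq 1
  rotInv_rot := starId_rotInv_rot hq 1
  rot_zero := mk_starId_rot_zero 1

/-- The functor inserting `k` strands on top of a diagram, just after the seam. -/
def idStarFunctor (hq : q ≠ 0) (k : ℕ) : StrandInsertion q k 0 where
  obj a := k + a
  obj_eq a := rfl
  map D := Hom.mk q (idStar k D)
  map_nil a := rfl
  map_comp := mk_idStar_comp k
  map_box := mk_idStar_box k
  rot_pc e i ha hb := idStar_rot_pc k e i ha hb
  rot_rot_cup i := by
    -- The cup first wraps around to place 0, and then the two sweeps carry it under the `k`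
    -- inserted strands to place `k`.
    rw [mk_idStar_rot_succ, Hom.comp_assoc, Hom.comp_assoc,
      assoc_of_eq (rt_sweep Piece.isCrossing_pos (by omega)), rt_rt_cup (by omega)]
    have h := sweep_sweep_cup hq Piece.isCrossing_pos (m := k + i) (n := k + (i + 2)) (i := 0)
      (s := k) (by omega) (by omega)
    rwa [zero_add k] at h
  cap_rot_rot i := by
    rw [mk_idStar_rot_succ, Hom.comp_assoc,
      assoc_of_eq (rt_sweep Piece.isCrossing_pos (by omega))]
    have h := cap_sweep_sweep hq Piece.isCrossing_pos (m := k + i) (n := k + (i + 2)) (i := 0)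
      (s := k) (by omega) (by omega)
    rw [zero_add k] at h
    rw [← cap_rt_rt (i := k + i) (by omega), ← h]
    simp only [Hom.comp_assoc]
  rot_rotInv := idStar_rot_rotInv hq k
  rotInv_rot := idStar_rotInv_rot hq k
  rot_zero := mk_idStar_rot_zero k

end star

/-! ### The interchange law for juxtaposition -/

section interchange

variable {q : ℂ}

theorem comp_eq_comp_of_inv {a b : ℕ} {g g' : Hom q b b} {f f' : Hom q a a} {x : Hom q a b}
    (hg : g' ⊙ g = idm q b) (hf : f ⊙ f' = idm q a) (h : g ⊙ x = x ⊙ f) :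
    g' ⊙ x = x ⊙ f' := by
  calc g' ⊙ x = g' ⊙ (x ⊙ f ⊙ f') := by rw [hf, comp_idm]
    _ = g' ⊙ g ⊙ x ⊙ f' := by rw [assoc_of_eq h]
    _ = x ⊙ f' := by rw [assoc_of_eq_one hg, idm_comp]

/-- A sweep with its first crossing split off. -/
theorem sweep_succ_left (x : Piece) (n i s : ℕ) :
    sweep q x n i (s + 1) = sweep q x n (i + 1) s ⊙ pc q x i n n := by
  induction s with
  | zero => rw [sweep, sweep, sweep, comp_idm, idm_comp, add_zero]
  | succ s ih =>
    rw [sweep, ih, sweep, Hom.comp_assoc]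
    congr 3; omega

/-- Sweeps over disjoint sets of places commute. -/
theorem sweep_comm {x y : Piece} (hx : x.IsCrossing) (hy : y.IsCrossing) {n i s j t : ℕ}
    (hij : i + s + 1 ≤ j) (h : j + t + 1 ≤ n) :
    sweep q y n j t ⊙ sweep q x n i s = sweep q x n i s ⊙ sweep q y n j t := by
  induction t with
  | zero => rw [sweep, idm_comp, comp_idm]
  | succ t ih =>
    rw [sweep, Hom.comp_assoc, ih (by omega), ← assoc_of_eq (sweep_pc_of_le hx y (by omega)
      (by rw [hy.src]; omega) (by rw [hy.src, hy.tgt]))]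

/-- On each side one pair of opposite crossings cancels: at place `a` on the left, and on the right
at place 0, where the last crossing of the over-sweep arrives after both rotations. The remaining
sweeps have disjoint supports and agree after being pulled through the rotations. -/
theorem sweep_neg_sweep_pos_rt (hq : q ≠ 0) (a c : ℕ) :
    (rt q (a + 1 + (c + 1)) ⊙ sweep q .neg (a + 1 + (c + 1)) a (c + 1)) ⊙
      sweep q .pos (a + 1 + (c + 1)) 0 (a + 1) ⊙ rt q (a + 1 + (c + 1)) =
    (sweep q .pos (a + 1 + (c + 1)) 0 (a + 1) ⊙ rt q (a + 1 + (c + 1))) ⊙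
      rt q (a + 1 + (c + 1)) ⊙ sweep q .neg (a + 1 + (c + 1)) a (c + 1) := by
  set n := a + 1 + (c + 1) with hn
  have hp := Piece.isCrossing_pos
  have hm := Piece.isCrossing_neg
  -- Here `a + c` is the last place at which a crossing of `n` strands fits, so it wraps around as a
  -- whole.
  have hwrap : rt q n ⊙ rt q n ⊙ pc q .neg (a + c) n n = pc q .neg 0 n n ⊙ rt q n ⊙ rt q n := by
    have h := rotPow_pc (q := q) .neg (i := a + c) (a := n) (b := n)
      (by rw [Piece.src]; omega) (by rw [Piece.tgt]; omega)
    rwa [Piece.tgt, Piece.src, mk_rotPow_two, Hom.comp_assoc] at h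
  have hleft : sweep q .neg n a (c + 1) ⊙ sweep q .pos n 0 (a + 1) =
      sweep q .pos n 0 a ⊙ sweep q .neg n (a + 1) c := by
    rw [sweep_succ_left, sweep, Hom.comp_assoc, zero_add,
      assoc_of_eq_one (neg_pos hq (by omega)), idm_comp, sweep_comm hp hm (by omega) (by omega)]
  have hright : rt q n ⊙ rt q n ⊙ sweep q .neg n a (c + 1) =
      pc q .neg 0 n n ⊙ rt q n ⊙ rt q n ⊙ sweep q .neg n a c := by
    rw [sweep, ← Hom.comp_assoc (rt q n) (rt q n), ← Hom.comp_assoc (rt q n ⊙ rt q n),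
      Hom.comp_assoc (rt q n), hwrap]
    simp only [Hom.comp_assoc]
  rw [Hom.comp_assoc, assoc_of_eq hleft, Hom.comp_assoc, hright, sweep_succ_left,
    Hom.comp_assoc, assoc_of_eq_one (pos_neg hq (by omega)), idm_comp,
    rt_sweep hm (by omega), assoc_of_eq (rt_sweep hp (by omega))]

/-- The interchange law: `D ∗ D'` does not depend on which of the two diagrams lies outside. -/
def Interchange (q : ℂ) {a b c d : ℕ} (D : Diagram a b) (D' : Diagram c d) : Prop :=
  Hom.mk q (starId d D) ⊙ Hom.mk q (idStar a D') = Hom.mk q (idStar b D') ⊙ Hom.mk q (starId c D)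

theorem interchange_box_box {a b c d : ℕ} (e e' : Piece) (i r i' r' : ℕ) (ha : a = i + e.src + r)
    (hb : b = i + e.tgt + r) (hc : c = i' + e'.src + r') (hd : d = i' + e'.tgt + r') :
    Interchange q (box e i r ha hb) (box e' i' r' hc hd) := by
  rw [Interchange, mk_starId_box, mk_starId_box, mk_idStar_box, mk_idStar_box,
    pc_interchange e e' (c := b + c) (by omega) (by omega) (by omega) (by omega) (by omega)]
  congr 3; omega

/-- The rotation pushes the piece from place `i` to `i + 1`, and the strand that came through the
seam, swept underneath it, brings it back. -/
theorem interchange_box_rot (hq : q ≠ 0) {a b n : ℕ} (e : Piece) (i r : ℕ)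
    (ha : a = i + e.src + r) (hb : b = i + e.tgt + r) :
    Interchange q (box e i r ha hb) (rot n) := by
  rw [Interchange, mk_starId_box]
  cases n with
  | zero => rw [mk_idStar_rot_zero, mk_idStar_rot_zero]; exact (comp_idm _).trans (idm_comp _).symm
  | succ n =>
    rw [mk_idStar_rot_succ, mk_idStar_rot_succ, Hom.comp_assoc,
      rt_pc e (by omega) (by omega)]
    have h := sweep_pc hq Piece.isCrossing_pos e (i := 0) (j := i) (s := a) (s' := b)
      (a := a + (n + 1)) (b := b + (n + 1)) (by omega) (by omega) (by omega) (by omega)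
    rw [zero_add] at h
    exact (assoc_of_eq h _).symm

theorem interchange_rot_box (hq : q ≠ 0) {n c d : ℕ} (e : Piece) (i r : ℕ)
    (hc : c = i + e.src + r) (hd : d = i + e.tgt + r) :
    Interchange q (rot n) (box e i r hc hd) := by
  rw [Interchange, mk_idStar_box]
  cases n with
  | zero => rw [mk_starId_rot_zero, mk_starId_rot_zero, comp_idm, idm_comp]
  | succ n =>
    have h := sweep_pc hq Piece.isCrossing_neg e (i := n) (j := i) (s := c) (s' := d)
      (a := n + 1 + c) (b := n + 1 + d) (by omega) (by omega) (by omega) (by omega)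
    rw [mk_starId_rot_succ, mk_starId_rot_succ, Hom.comp_assoc,
      show n + 1 + i = n + i + 1 by omega, h, assoc_of_eq (rt_pc e (by omega) (by omega))]

theorem interchange_rot_rot (hq : q ≠ 0) (a c : ℕ) : Interchange q (rot a) (rot c) := by
  rw [Interchange]
  cases a with
  | zero => rw [mk_starId_rot_zero, comp_idm, idm_comp]
  | succ a =>
    cases c with
    | zero => rw [mk_idStar_rot_zero, comp_idm]; exact (idm_comp _).symm
    | succ c =>
      rw [mk_starId_rot_succ, mk_idStar_rot_succ, sweep_neg_sweep_pos_rt hq]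

theorem interchange_rotInv_left (hq : q ≠ 0) {n c d : ℕ} {D' : Diagram c d}
    (h : Interchange q (rot n) D') : Interchange q (rotInv n) D' := by
  exact comp_eq_comp_of_inv (starId_rotInv_rot hq d n) (starId_rot_rotInv hq c n) h

theorem interchange_rotInv_right (hq : q ≠ 0) {n a b : ℕ} {D : Diagram a b}
    (h : Interchange q D (rot n)) : Interchange q D (rotInv n) := by
  exact (comp_eq_comp_of_inv (idStar_rotInv_rot hq b n) (idStar_rot_rotInv hq a n) h.symm).symm

theorem interchange_slice (hq : q ≠ 0) {a b c d : ℕ} (s : Slice a b) (s' : Slice c d) :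
    Interchange q (ofSlice s) (ofSlice s') := by
  cases s with
  | box e i r ha hb =>
    cases s' with
    | box e' i' r' hc hd => exact interchange_box_box e e' i r i' r' ha hb hc hd
    | rot => exact interchange_box_rot hq e i r ha hb
    | rotInv => exact interchange_rotInv_right hq (interchange_box_rot hq e i r ha hb)
  | rot =>
    cases s' with
    | box e' i' r' hc hd => exact interchange_rot_box hq e' i' r' hc hd
    | rot => exact interchange_rot_rot hq _ _
    | rotInv => exact interchange_rotInv_right hq (interchange_rot_rot hq _ _)
  | rotInv =>
    refine interchange_rotInv_left hq ?_
    cases s' with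
    | box e' i' r' hc hd => exact interchange_rot_box hq e' i' r' hc hd
    | rot => exact interchange_rot_rot hq _ _
    | rotInv => exact interchange_rotInv_right hq (interchange_rot_rot hq _ _)

theorem Interchange.comp_left {a b b' c d : ℕ} {D₂ : Diagram b b'} {D₁ : Diagram a b}
    {D' : Diagram c d} (h₂ : Interchange q D₂ D') (h₁ : Interchange q D₁ D') :
    Interchange q (D₂.comp D₁) D' := by
  rw [Interchange] at *
  rw [mk_starId_comp, mk_starId_comp, Hom.comp_assoc, h₁, assoc_of_eq h₂]

theorem Interchange.comp_right {a b c d d' : ℕ} {D : Diagram a b} {D₂ : Diagram d d'}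
    {D₁ : Diagram c d} (h₂ : Interchange q D D₂) (h₁ : Interchange q D D₁) :
    Interchange q D (D₂.comp D₁) := by
  rw [Interchange] at *
  rw [mk_idStar_comp, mk_idStar_comp, Hom.comp_assoc, ← h₁, assoc_of_eq h₂]

theorem interchange (hq : q ≠ 0) {a b c d : ℕ} (D : Diagram a b) (D' : Diagram c d) :
    Interchange q D D' := by
  induction D with
  | nil => exact (idm_comp _).trans (comp_idm _).symm
  | cons s D ih =>
    refine Interchange.comp_left (D₂ := ofSlice s) ?_ ih
    clear ih
    induction D' with
    | nil => exact (comp_idm _).trans (idm_comp _).symm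
    | cons s' D' ih => exact Interchange.comp_right (interchange_slice hq s s') ih

end interchange

/-! ### Juxtaposition on skein modules -/

section fusion

variable {q : ℂ}

/-- The map `Y ↦ Y ∗ Id_1` on skein modules. -/
def starHom (hq : q ≠ 0) {a b : ℕ} : Hom q a b →ₗ[ℂ] Hom q (a + 1) (b + 1) :=
  (starFunctor hq).hom a b

/-- The map `Z ↦ Id_k ∗ Z` on skein modules. -/
def idStarHom (hq : q ≠ 0) (k : ℕ) {a b : ℕ} : Hom q a b →ₗ[ℂ] Hom q (k + a) (k + b) :=
  (idStarFunctor hq k).hom a b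

theorem starHom_mk (hq : q ≠ 0) {a b : ℕ} (D : Diagram a b) :
    starHom hq (Hom.mk q D) = Hom.mk q (starId 1 D) := (starFunctor hq).hom_mk D

theorem idStarHom_mk (hq : q ≠ 0) (k : ℕ) {a b : ℕ} (D : Diagram a b) :
    idStarHom hq k (Hom.mk q D) = Hom.mk q (idStar k D) := (idStarFunctor hq k).hom_mk D

theorem starHom_comp (hq : q ≠ 0) {a b c : ℕ} (g : Hom q b c) (f : Hom q a b) :
    starHom hq (g ⊙ f) = starHom hq g ⊙ starHom hq f := (starFunctor hq).hom_comp g f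

theorem idStarHom_comp (hq : q ≠ 0) (k : ℕ) {a b c : ℕ} (g : Hom q b c) (f : Hom q a b) :
    idStarHom hq k (g ⊙ f) = idStarHom hq k g ⊙ idStarHom hq k f :=
  (idStarFunctor hq k).hom_comp g f

theorem starHom_idm (hq : q ≠ 0) (a : ℕ) : starHom hq (idm q a) = idm q (a + 1) :=
  (starFunctor hq).hom_idm a

theorem idStarHom_idm (hq : q ≠ 0) (k a : ℕ) : idStarHom hq k (idm q a) = idm q (k + a) :=
  (idStarFunctor hq k).hom_idm a

theorem starHom_pc (hq : q ≠ 0) (e : Piece) {i a b : ℕ} (ha : i + e.src ≤ a)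
    (hb : b + e.src = a + e.tgt) : starHom hq (pc q e i a b) = pc q e i (a + 1) (b + 1) := by
  have h := (starFunctor hq).hom_pc e ha hb
  rwa [zero_add] at h

theorem starHom_rt_succ (hq : q ≠ 0) (n : ℕ) :
    starHom hq (rt q (n + 1)) = rt q (n + 2) ⊙ pc q .neg n (n + 2) (n + 2) := by
  rw [rt, starHom_mk, mk_starId_rot_succ, sweep_one]

theorem interchange_hom (hq : q ≠ 0) {a b : ℕ} (Y : Hom q a b) (Z : Hom q 1 1) :
    starHom hq Y ⊙ idStarHom hq a Z = idStarHom hq b Z ⊙ starHom hq Y := by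
  induction Y using Hom.induction_mk with
  | h0 => simp
  | hadd x y hx hy => rw [map_add, add_comp, comp_add, hx, hy]
  | hsmul r x hx => rw [map_smul, smul_comp, comp_smul, hx]
  | hmk D =>
    induction Z using Hom.induction_mk with
    | h0 => simp
    | hadd x y hx hy =>
      rw [map_add (idStarHom hq a), map_add (idStarHom hq b), add_comp, comp_add, hx, hy]
    | hsmul r x hx =>
      rw [map_smul (idStarHom hq a), map_smul (idStarHom hq b), smul_comp, comp_smul, hx]
    | hmk D' =>
      rw [starHom_mk, idStarHom_mk, idStarHom_mk]
      exact interchange hq D D'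

/-! ### Module maps out of a fusion product -/

/-- The submodule of `Hom(a, n)` generated by all `Y ∘ x - s Y`. -/
abbrev eigenRelations {a : ℕ} (x : Hom q a a) (s : ℂ) (n : ℕ) : Submodule (TL q n) (Hom q a n) :=
  Submodule.span (TL q n) {z : Hom q a n | ∃ Y : Hom q a n, z = Hom.comp Y x - s • Y}

theorem comp_sub_smul_mem_eigenRelations {a n : ℕ} (x : Hom q a a) (s : ℂ) (Y : Hom q a n) :
    Y ⊙ x - s • Y ∈ eigenRelations x s n := Submodule.subset_span ⟨Y, rfl⟩

/-- Composing with `x` on the inside commutes with the action of `TL` from the outside, so the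
generators already form a submodule. -/
theorem mem_eigenRelations_iff {a n : ℕ} {x : Hom q a a} {s : ℂ} {z : Hom q a n} :
    z ∈ eigenRelations x s n ↔ ∃ Y : Hom q a n, z = Y ⊙ x - s • Y := by
  refine ⟨fun h => ?_, fun ⟨Y, hY⟩ => hY ▸ comp_sub_smul_mem_eigenRelations x s Y⟩
  induction h using Submodule.span_induction with
  | mem z hz => exact hz
  | zero => exact ⟨0, by simp⟩
  | add z z' _ _ h h' =>
    obtain ⟨Y, rfl⟩ := h
    obtain ⟨Y', rfl⟩ := h'
    exact ⟨Y + Y', by rw [add_comp, smul_add]; abel⟩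
  | smul T z _ h =>
    obtain ⟨Y, rfl⟩ := h
    refine ⟨Hom.comp (q := q) (b := n) T Y, ?_⟩
    have h1 : T • (Y ⊙ x - s • Y) = Hom.comp (q := q) (b := n) T (Y ⊙ x) -
        Hom.comp (q := q) (b := n) T (s • Y) := map_sub (Hom.comp (q := q) (b := n) T) _ _
    rw [h1, map_smul]
    exact congrArg (· - _) (Hom.comp_assoc (q := q) (c := n) T Y x).symm

/-- A complex linear map descends to the quotient by a submodule over a larger ring. -/
def quotientLift {A M N : Type*} [Ring A] [Algebra ℂ A] [AddCommGroup M] [Module ℂ M] [Module A M]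
    [IsScalarTower ℂ A M] [AddCommGroup N] [Module ℂ N] (P : Submodule A M) (f : M →ₗ[ℂ] N)
    (h : ∀ x ∈ P, f x = 0) : (M ⧸ P) →ₗ[ℂ] N :=
  (P.restrictScalars ℂ).liftQ f (fun x hx => h x hx) ∘ₗ
    (Submodule.Quotient.restrictScalarsEquiv ℂ P).symm.toLinearMap

/-- A bilinear map on the factors which is compatible with juxtaposition of diagrams induces a
module map on the fusion product. -/
theorem exists_fusion_lift {n m : ℕ} {M₁ M₂ Q : Type*}
    [AddCommGroup M₁] [Module ℂ M₁] [Module (TL q n) M₁] [IsScalarTower ℂ (TL q n) M₁]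
    [AddCommGroup M₂] [Module ℂ M₂] [Module (TL q m) M₂] [IsScalarTower ℂ (TL q m) M₂]
    [AddCommGroup Q] [Module ℂ Q] [Module (TL q (n + m)) Q] [IsScalarTower ℂ (TL q (n + m)) Q]
    (β : M₁ →ₗ[ℂ] M₂ →ₗ[ℂ] Q)
    (hβ : ∀ (D : Diagram n n) (D' : Diagram m m) (x : M₁) (y : M₂),
      β (TL.mk q D • x) (TL.mk q D' • y) = TL.mk q (D.star D') • β x y) :
    ∃ f : Fusion q n m M₁ M₂ →ₗ[TL q (n + m)] Q,
      ∀ (T : TL q (n + m)) (x : M₁) (y : M₂),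
        f (Submodule.Quotient.mk (T ⊗ₜ[ℂ] (x ⊗ₜ[ℂ] y))) = T • β x y := by
  let γ : TL q (n + m) →ₗ[ℂ] (M₁ ⊗[ℂ] M₂) →ₗ[ℂ] Q :=
    LinearMap.mk₂ ℂ (fun T z => T • TensorProduct.lift β z)
      (fun T T' z => add_smul _ _ _) (fun r T z => smul_assoc _ _ _)
      (fun T z z' => by rw [map_add, smul_add])
      (fun r T z => by rw [map_smul]; exact smul_algebra_smul_comm r T _)
  let g : TL q (n + m) ⊗[ℂ] (M₁ ⊗[ℂ] M₂) →ₗ[TL q (n + m)] Q :=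
    { TensorProduct.lift γ with
      map_smul' := fun T z => by
        change TensorProduct.lift γ (T • z) = T • TensorProduct.lift γ z
        induction z using TensorProduct.induction_on with
        | zero => simp
        | tmul T' z =>
          rw [TensorProduct.smul_tmul', TensorProduct.lift.tmul, TensorProduct.lift.tmul]
          exact mul_smul T T' (TensorProduct.lift β z)
        | add x y hx hy => rw [smul_add, map_add, map_add, smul_add, hx, hy] }
  have hg : ∀ (T : TL q (n + m)) (x : M₁) (y : M₂),
      g (T ⊗ₜ[ℂ] (x ⊗ₜ[ℂ] y)) = T • β x y := fun T x y => rfl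
  refine ⟨Submodule.liftQ _ g (Submodule.span_le.2 ?_), fun T x y => rfl⟩
  rintro _ ⟨Z, D, D', x, y, rfl⟩
  rw [SetLike.mem_coe, LinearMap.mem_ker, map_sub, hg, hg, hβ, mul_smul, sub_self]

theorem exists_bilinear_quotient_lift {A₁ A₂ M N Q : Type*} [Ring A₁] [Algebra ℂ A₁] [Ring A₂]
    [Algebra ℂ A₂] [AddCommGroup M] [Module ℂ M] [Module A₁ M] [IsScalarTower ℂ A₁ M]
    [AddCommGroup N] [Module ℂ N] [Module A₂ N] [IsScalarTower ℂ A₂ N] [AddCommGroup Q] [Module ℂ Q]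
    (P₁ : Submodule A₁ M) (P₂ : Submodule A₂ N) (B : M →ₗ[ℂ] N →ₗ[ℂ] Q)
    (h₁ : ∀ x ∈ P₁, ∀ y, B x y = 0) (h₂ : ∀ y ∈ P₂, ∀ x, B x y = 0) :
    ∃ β : (M ⧸ P₁) →ₗ[ℂ] (N ⧸ P₂) →ₗ[ℂ] Q,
      ∀ x y, β (Submodule.Quotient.mk x) (Submodule.Quotient.mk y) = B x y := by
  let β₁ := quotientLift P₁ B fun x hx => LinearMap.ext (h₁ x hx)
  refine ⟨(quotientLift P₂ β₁.flip fun y hy => LinearMap.ext fun x => ?_).flip, fun x y => rfl⟩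
  obtain ⟨x, rfl⟩ := Submodule.Quotient.mk_surjective P₁ x
  exact h₂ y hy x

theorem exists_fusion_lift_quotient {n m : ℕ} {M N Q : Type*}
    [AddCommGroup M] [Module ℂ M] [Module (TL q n) M] [IsScalarTower ℂ (TL q n) M]
    [AddCommGroup N] [Module ℂ N] [Module (TL q m) N] [IsScalarTower ℂ (TL q m) N]
    [AddCommGroup Q] [Module ℂ Q] [Module (TL q (n + m)) Q] [IsScalarTower ℂ (TL q (n + m)) Q]
    (P₁ : Submodule (TL q n) M) (P₂ : Submodule (TL q m) N) (B : M →ₗ[ℂ] N →ₗ[ℂ] Q)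
    (h₁ : ∀ x ∈ P₁, ∀ y, B x y = 0) (h₂ : ∀ y ∈ P₂, ∀ x, B x y = 0)
    (hB : ∀ (D : Diagram n n) (D' : Diagram m m) (x : M) (y : N),
      B (TL.mk q D • x) (TL.mk q D' • y) = TL.mk q (D.star D') • B x y) :
    ∃ f : Fusion q n m (M ⧸ P₁) (N ⧸ P₂) →ₗ[TL q (n + m)] Q,
      ∀ (T : TL q (n + m)) (x : M) (y : N),
        f (Submodule.Quotient.mk (T ⊗ₜ[ℂ]
          (Submodule.Quotient.mk x ⊗ₜ[ℂ] Submodule.Quotient.mk y))) = T • B x y := by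
  obtain ⟨β, hβ⟩ := exists_bilinear_quotient_lift P₁ P₂ B h₁ h₂
  obtain ⟨f, hf⟩ := exists_fusion_lift (q := q) (n := n) (m := m) β (by
    intro D D' x y
    obtain ⟨x, rfl⟩ := Submodule.Quotient.mk_surjective P₁ x
    obtain ⟨y, rfl⟩ := Submodule.Quotient.mk_surjective P₂ y
    rw [← Submodule.Quotient.mk_smul, ← Submodule.Quotient.mk_smul, hβ, hβ, hB])
  exact ⟨f, fun T x y => by rw [hf, hβ]⟩

/-- The pairing `(Y, Z) ↦ (Y ∗ Z) ∘ w` with values in a quotient of `Hom(c, n + 1)`. -/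
def fusionPairing (hq : q ≠ 0) {a c n : ℕ} (R : Submodule (TL q (n + 1)) (Hom q c (n + 1)))
    (w : Hom q c (a + 1)) : Hom q a n →ₗ[ℂ] Hom q 1 1 →ₗ[ℂ] (Hom q c (n + 1) ⧸ R) :=
  LinearMap.mk₂ ℂ
    (fun Y Z => Submodule.Quotient.mk (p := R) (starHom hq Y ⊙ idStarHom hq a Z ⊙ w))
    (fun Y Y' Z => by rw [map_add, add_comp, Submodule.Quotient.mk_add])
    (fun r Y Z => by rw [map_smul, smul_comp, Submodule.Quotient.mk_smul])
    (fun Y Z Z' => by rw [map_add, add_comp, comp_add, Submodule.Quotient.mk_add])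
    (fun r Y Z => by rw [map_smul, smul_comp, comp_smul, Submodule.Quotient.mk_smul])

theorem fusionPairing_apply (hq : q ≠ 0) {a c n : ℕ}
    (R : Submodule (TL q (n + 1)) (Hom q c (n + 1))) (w : Hom q c (a + 1)) (Y : Hom q a n)
    (Z : Hom q 1 1) : fusionPairing hq R w Y Z =
      Submodule.Quotient.mk (starHom hq Y ⊙ idStarHom hq a Z ⊙ w) := rfl

/-- Equivariance of the pairing: functoriality on each side and one interchange of T' with Y. -/
theorem starHom_comp_idStarHom_comp (hq : q ≠ 0) {a c n : ℕ} (T : Hom q n n) (T' : Hom q 1 1)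
    (Y : Hom q a n) (Z : Hom q 1 1) (w : Hom q c (a + 1)) :
    starHom hq (T ⊙ Y) ⊙ idStarHom hq a (T' ⊙ Z) ⊙ w =
      (starHom hq T ⊙ idStarHom hq n T') ⊙ starHom hq Y ⊙ idStarHom hq a Z ⊙ w := by
  rw [starHom_comp, idStarHom_comp, Hom.comp_assoc, Hom.comp_assoc, Hom.comp_assoc,
    assoc_of_eq (interchange_hom hq Y T')]

/-- The criterion used for both maps. `hx` and `hv` say that `w` is an eigenvector modulo the
relations of the target, tested after any further composition `A`; `hw` says that `w`, enlarged by
some `Y`, can be undone modulo these relations. -/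
theorem exists_surjective_fusion_map (hq : q ≠ 0) {a c n : ℕ} (x : Hom q a a) (s : ℂ)
    (y : Hom q c c) (u v : ℂ) (w : Hom q c (a + 1))
    (hx : ∀ A : Hom q (a + 1) (n + 1),
      A ⊙ starHom hq x ⊙ w - s • (A ⊙ w) ∈ eigenRelations y u (n + 1))
    (hv : ∀ A : Hom q (a + 1) (n + 1),
      A ⊙ idStarHom hq a (rho q) ⊙ w - v • (A ⊙ w) ∈ eigenRelations y u (n + 1))
    (hw : ∃ (Y : Hom q a n) (C : Hom q (n + 1) c), ∀ D : Hom q c (n + 1),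
      D ⊙ C ⊙ starHom hq Y ⊙ w - D ∈ eigenRelations y u (n + 1)) :
    ∃ f : Fusion q n 1 (Hom q a n ⧸ eigenRelations x s n) (VOdd q v 1)
        →ₗ[TL q (n + 1)] (Hom q c (n + 1) ⧸ eigenRelations y u (n + 1)),
      Function.Surjective f := by
  have h₁ : ∀ Y ∈ eigenRelations x s n, ∀ Z,
      fusionPairing hq (eigenRelations y u (n + 1)) w Y Z = 0 := by
    intro Y hY Z
    obtain ⟨Y, rfl⟩ := mem_eigenRelations_iff.1 hY
    refine (Submodule.Quotient.mk_eq_zero _).2 ?_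
    -- In (Yx ∗ Z) ∘ w the factor x ∗ Id₁ stands outside Id ∗ Z; interchange moves it next to `w`,
    -- where `hx` applies.
    have h1 := hx (starHom hq Y ⊙ idStarHom hq a Z)
    rw [Hom.comp_assoc, ← assoc_of_eq (interchange_hom hq x Z), Hom.comp_assoc] at h1
    rw [map_sub, map_smul, starHom_comp, LinearMap.map_sub₂, smul_comp, Hom.comp_assoc]
    exact h1
  have h₂ : ∀ Z ∈ eigenRelations (rho q) v 1, ∀ Y,
      fusionPairing hq (eigenRelations y u (n + 1)) w Y Z = 0 := by
    intro Z hZ Y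
    obtain ⟨Z, rfl⟩ := mem_eigenRelations_iff.1 hZ
    refine (Submodule.Quotient.mk_eq_zero _).2 ?_
    have h1 := hv (starHom hq Y ⊙ idStarHom hq a Z)
    rw [Hom.comp_assoc, Hom.comp_assoc] at h1
    rw [map_sub, map_smul, idStarHom_comp, LinearMap.map_sub₂, smul_comp, map_sub, comp_smul,
      Hom.comp_assoc]
    exact h1
  obtain ⟨f, hf⟩ := exists_fusion_lift_quotient (q := q) (n := n) (m := 1) _ _ _ h₁ h₂
    (fun D D' Y Z => by
      rw [fusionPairing_apply, fusionPairing_apply, ← Submodule.Quotient.mk_smul]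
      refine congrArg _ ((starHom_comp_idStarHom_comp hq (Hom.mk q D) (Hom.mk q D') Y Z w).trans ?_)
      rw [starHom_mk, idStarHom_mk, ← Hom.mk_comp]
      rfl)
  refine ⟨f, fun D => ?_⟩
  obtain ⟨D, rfl⟩ := Submodule.Quotient.mk_surjective _ D
  obtain ⟨Y, C, h⟩ := hw
  -- The preimage lets `D ⊙ C` act on the pair (Y, id), whose image (Y ∗ Id₁) ∘ w is undone by `C`.
  refine ⟨Submodule.Quotient.mk ((show TL q (n + 1) from D ⊙ C) ⊗ₜ[ℂ]
    (Submodule.Quotient.mk Y ⊗ₜ[ℂ] Submodule.Quotient.mk (idm q 1))), ?_⟩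
  rw [hf, fusionPairing_apply, ← Submodule.Quotient.mk_smul]
  refine (Submodule.Quotient.eq _).2 ?_
  have h' := h D
  rw [← Hom.comp_assoc D] at h'
  rw [idStarHom_idm, idm_comp]
  exact h'

/-- Nested cups beside the other strands have a left inverse as soon as a strand is added. -/
theorem exists_left_inverse_starHom (hq : q ≠ 0) (a k : ℕ) :
    ∃ (Y : Hom q a (a + 2 * k)) (C : Hom q (a + 2 * k + 1) (a + 1)),
      C ⊙ starHom hq Y = idm q (a + 1) := by
  induction k with
  | zero => exact ⟨idm q a, idm q (a + 1), (idm_comp _).trans (starHom_idm hq a)⟩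
  | succ k ih =>
    obtain ⟨Y, C, h⟩ := ih
    -- The cap at place 1 joins the right leg of the new cup to the next strand, making a zigzag.
    -- Such a strand exists even for `a = 0` and `k = 0`, thanks to the added one.
    refine ⟨pc q .cup 0 (a + 2 * k) (a + 2 * (k + 1)) ⊙ Y,
      C ⊙ pc q .cap 1 (a + 2 * (k + 1) + 1) (a + 2 * k + 1), ?_⟩
    rw [starHom_comp, starHom_pc hq _ (by simp only [Piece.src]; omega)
      (by simp only [Piece.src, Piece.tgt]; omega), Hom.comp_assoc,
      assoc_of_eq_one (cap_succ_cup (i := 0) (by omega) (by omega)), idm_comp, h]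

/-! ### Eigenvectors for the two maps -/

theorem loopX_eq : loopX q = pc q .cap 0 2 0 ⊙ rt q 2 ⊙ pc q .cup 0 0 2 := by
  rw [← mk_box (a := 2) (b := 0) .cap 0 0 rfl rfl, ← mk_box (a := 0) (b := 2) .cup 0 0 rfl rfl, rt,
    ← Hom.mk_comp, ← Hom.mk_comp]
  rfl

/-- The loop crosses the added strand once. The two smoothings of that crossing merge loop and
strand into one strand winding counterclockwise (coefficient q) or clockwise (coefficient q⁻¹). -/
theorem starHom_loopX (hq : q ≠ 0) :
    (starHom hq (loopX q) : Hom q 1 1) = q • rt q 1 + q⁻¹ • rti q 1 := by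
  have h1 : rt q 3 ⊙ pc q .cup 0 1 3 = pc q .cup 1 1 3 ⊙ rt q 1 := rt_pc .cup (le_refl _) rfl
  have h2 : rt q 3 ⊙ pc q .cup 1 1 3 = rti q 3 ⊙ pc q .cup 0 1 3 := by
    rw [← rt_rt_cup (i := 1) rfl, assoc_of_eq_one (rti_rt 3), idm_comp]
  have h3 : rt q 1 ⊙ pc q .cap 0 3 1 = pc q .cap 1 3 1 ⊙ rt q 3 := rt_pc .cap (le_refl _) rfl
  have h4 : pc q .cap 0 3 1 ⊙ rti q 3 = rti q 1 ⊙ pc q .cap 1 3 1 := by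
    rw [← comp_idm (pc q .cap 1 3 1), ← rt_rti, ← assoc_of_eq h3, assoc_of_eq_one (rti_rt 1),
      idm_comp]
  have h5 : pc q .cap 1 3 1 ⊙ pc q .cup 0 1 3 = idm q 1 := cap_succ_cup (i := 0) rfl (le_refl _)
  have h6 : pc q .cap 0 3 1 ⊙ pc q .cup 1 1 3 = idm q 1 := cap_cup_succ (i := 0) rfl (le_refl _)
  have hneg : pc q .neg 1 3 3 = q⁻¹ • (pc q .cup 1 1 3 ⊙ pc q .cap 1 3 1) + q • idm q 3 :=
    kauffman_neg 1 rfl (le_refl _)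
  have hcap : starHom hq (pc q .cap 0 2 0) = pc q .cap 0 3 1 := starHom_pc hq .cap (le_refl _) rfl
  have hcup : starHom hq (pc q .cup 0 0 2) = pc q .cup 0 1 3 := starHom_pc hq .cup (le_refl _) rfl
  rw [loopX_eq, starHom_comp, starHom_comp, hcap, hcup, starHom_rt_succ]
  change pc q .cap 0 3 1 ⊙ (rt q 3 ⊙ pc q .neg 1 3 3) ⊙ pc q .cup 0 1 3 = _
  rw [hneg]
  simp only [add_comp, smul_comp, comp_add, comp_smul, comp_idm, Hom.comp_assoc]
  rw [h5, comp_idm, h1, h2, assoc_of_eq_one h6, idm_comp, assoc_of_eq h4, h5, comp_idm, add_comm]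

theorem idStarHom_zero_rho (hq : q ≠ 0) : (idStarHom hq 0 (rho q) : Hom q 1 1) = rt q 1 := by
  rw [rho, idStarHom_mk, mk_idStar_rot_succ, sweep]
  exact idm_comp _

/-- The vector of `Hom(0, 2)` on which both strands can be wound around the annulus. -/
def fusionVector (q v : ℂ) : Hom q 0 2 :=
  q • pc q .cup 0 0 2 + v • (rt q 2 ⊙ pc q .cup 0 0 2)

theorem rt_rt_cup_two : rt q 2 ⊙ rt q 2 ⊙ pc q .cup 0 0 2 = pc q .cup 0 0 2 :=
  rt_rt_cup (i := 0) rfl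

/-- Modulo X = u, ρ ∗ Id₁ preserves the span of c = cup and c' = rotated cup: c ↦ -q⁻³c' and c' ↦ qc
+ q⁻¹uc'. This matrix has trace v + q⁻²v⁻¹ and determinant q⁻², and qc + vc' is an eigenvector for
v. The last summand is the explicit error before imposing X = u. -/
theorem starHom_rho_fusionVector (hq : q ≠ 0) {v : ℂ} (hv : v ≠ 0) :
    Hom.comp (q := q) (b := 2) (c := 2) (starHom hq (rho q)) (fusionVector q v) =
      v • fusionVector q v + (v * q⁻¹) • ((rt q 2 ⊙ pc q .cup 0 0 2) ⊙ loopX q -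
        (q * v + q⁻¹ * v⁻¹) • (rt q 2 ⊙ pc q .cup 0 0 2)) := by
  have hc : pc q .cap 0 2 0 ⊙ pc q .cup 0 0 2 = (-(q ^ 2 + (q ^ 2)⁻¹)) • idm q 0 :=
    cap_cup rfl (le_refl _)
  have hneg : pc q .neg 0 2 2 = q⁻¹ • (pc q .cup 0 0 2 ⊙ pc q .cap 0 2 0) + q • idm q 2 :=
    kauffman_neg 0 rfl (le_refl _)
  have h : (starHom hq (rho q) : Hom q 2 2) = rt q 2 ⊙ pc q .neg 0 2 2 := starHom_rt_succ hq 0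
  rw [h, hneg, fusionVector]
  simp only [add_comp, smul_comp, comp_add, comp_smul, comp_idm, Hom.comp_assoc, hc,
    ← loopX_eq, rt_rt_cup_two]
  match_scalars <;> field_simp <;> ring

/-- The same vector is an eigenvector of Id₁ ∗ ρ with the inverse eigenvalue, again up to an
explicit multiple of the relation X = u. -/
theorem idStarHom_rho_fusionVector (hq : q ≠ 0) {v : ℂ} (hv : v ≠ 0) :
    Hom.comp (q := q) (b := 2) (c := 2) (idStarHom hq 1 (rho q)) (fusionVector q v) =
      v⁻¹ • fusionVector q v + (q ^ 2) • (pc q .cup 0 0 2 ⊙ loopX q -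
        (q * v + q⁻¹ * v⁻¹) • pc q .cup 0 0 2) := by
  have hc : pc q .cap 0 2 0 ⊙ pc q .cup 0 0 2 = (-(q ^ 2 + (q ^ 2)⁻¹)) • idm q 0 :=
    cap_cup rfl (le_refl _)
  have hpos : pc q .pos 0 2 2 = q • (pc q .cup 0 0 2 ⊙ pc q .cap 0 2 0) + q⁻¹ • idm q 2 :=
    kauffman_pos 0 rfl (le_refl _)
  have h : (idStarHom hq 1 (rho q) : Hom q 2 2) = pc q .pos 0 2 2 ⊙ rt q 2 := by
    rw [rho, idStarHom_mk, mk_idStar_rot_succ, sweep_one]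
  rw [h, hpos, fusionVector]
  simp only [add_comp, smul_comp, comp_add, comp_smul, idm_comp, comp_idm, Hom.comp_assoc, hc,
    ← loopX_eq, rt_rt_cup_two]
  match_scalars <;> field_simp <;> ring

theorem cap_fusionVector (hq : q ≠ 0) {v : ℂ} (hv : v ≠ 0) :
    pc q .cap 0 2 0 ⊙ fusionVector q v = (q * (v ^ 2 - q ^ 2)) • idm q 0 +
      v • (loopX q - (q * v + q⁻¹ * v⁻¹) • idm q 0) := by
  have hc : pc q .cap 0 2 0 ⊙ pc q .cup 0 0 2 = (-(q ^ 2 + (q ^ 2)⁻¹)) • idm q 0 :=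
    cap_cup rfl (le_refl _)
  rw [fusionVector, comp_add, comp_smul, comp_smul, hc, ← loopX_eq]
  match_scalars <;> field_simp <;> ring

theorem complex_smul_mem {a n : ℕ} (P : Submodule (TL q n) (Hom q a n)) (r : ℂ) {z : Hom q a n}
    (hz : z ∈ P) : r • z ∈ P := (P.restrictScalars ℂ).smul_mem r hz

/-! ### The two surjections -/

theorem exists_surjective_fusion_odd (hq : q ≠ 0) {v : ℂ} (hv : v ≠ 0) {n k : ℕ}
    (hn : n = 0 + 2 * k) :
    ∃ f : Fusion q n 1 (VEven q (q * v + q⁻¹ * v⁻¹) n) (VOdd q v 1)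
        →ₗ[TL q (n + 1)] VOdd q v (n + 1), Function.Surjective f := by
  subst hn
  obtain ⟨Y, C, h⟩ := exists_left_inverse_starHom hq 0 k
  refine exists_surjective_fusion_map hq (a := 0) (c := 1) (loopX q) _ (rho q) v v (idm q 1)
    (fun A => ?_) (fun A => ?_) ⟨Y, C, fun D => ?_⟩
  · have hA : ∀ z : Hom q 1 (0 + 2 * k + 1), z ⊙ rt q 1 - v • z ∈ eigenRelations (rho q) v _ :=
      comp_sub_smul_mem_eigenRelations (rho q) v
    change Hom.comp (q := q) (b := 1) A (Hom.comp (q := q) (b := 1) (starHom hq (loopX q)) (idm q 1))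
      - _ • Hom.comp (q := q) (b := 1) A (idm q 1) ∈ _
    rw [starHom_loopX, comp_idm, comp_idm]
    change Hom q 1 (0 + 2 * k + 1) at A
    have h1 := complex_smul_mem _ q (hA A)
    -- Applying the relation to A ∘ ρ⁻¹ shows that ρ⁻¹ acts by v⁻¹; the coefficient makes this the
    -- q⁻¹ρ⁻¹ part of X ∗ Id₁.
    have h2 := complex_smul_mem _ (-(q⁻¹ * v⁻¹)) (hA (A ⊙ rti q 1))
    rw [Hom.comp_assoc, rti_rt, comp_idm] at h2
    convert add_mem h1 h2 using 1
    rw [comp_add, comp_smul, comp_smul]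
    match_scalars <;> field_simp <;> ring
  · change Hom.comp (q := q) (b := 1) A
        (Hom.comp (q := q) (b := 1) (idStarHom hq 0 (rho q)) (idm q 1))
      - _ • Hom.comp (q := q) (b := 1) A (idm q 1) ∈ _
    rw [idStarHom_zero_rho, comp_idm, comp_idm]
    exact comp_sub_smul_mem_eigenRelations (rho q) v _
  · have h' : C ⊙ starHom hq Y ⊙ idm q 1 = idm q 1 := (congrArg _ (comp_idm _)).trans h
    rw [h', comp_idm, sub_self]
    exact zero_mem _

theorem exists_surjective_fusion_even (hq : q ≠ 0) {v : ℂ} (hv : v ≠ 0) (hvq : v ^ 2 ≠ q ^ 2)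
    {n k : ℕ} (hn : n = 1 + 2 * k) :
    ∃ f : Fusion q n 1 (VOdd q v n) (VOdd q v⁻¹ 1)
        →ₗ[TL q (n + 1)] VEven q (q * v + q⁻¹ * v⁻¹) (n + 1),
      Function.Surjective f := by
  subst hn
  obtain ⟨Y, C, h⟩ := exists_left_inverse_starHom hq 1 k
  set u := q * v + q⁻¹ * v⁻¹ with hu
  -- The error terms of both eigenvector identities have this shape, which composition from the
  -- outside preserves.
  have hR : ∀ (n : ℕ) (A : Hom q 2 n) (z : Hom q 0 2) (r : ℂ),
      Hom.comp (q := q) (b := 2) A (r • (z ⊙ loopX q - u • z)) ∈ eigenRelations (loopX q) u n := by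
    intro n A z r
    rw [comp_smul]
    refine complex_smul_mem _ r ?_
    rw [map_sub, comp_smul, ← Hom.comp_assoc]
    exact comp_sub_smul_mem_eigenRelations _ _ _
  refine exists_surjective_fusion_map hq (a := 1) (c := 0) (rho q) _ (loopX q) u v⁻¹
    (fusionVector q v) (fun A => ?_) (fun A => ?_)
    -- `C` recovers `w` from (Y ∗ Id₁) ∘ w, and the cap sends `w` to q(v² - q²) modulo X = u; the
    -- scalar normalizes this to the identity.
    ⟨Y, (q * (v ^ 2 - q ^ 2))⁻¹ • (Hom.comp (q := q) (b := 2) (pc q .cap 0 2 0) C), fun D => ?_⟩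
  · have h1 := congrArg (Hom.comp (q := q) (b := 2) A) (starHom_rho_fusionVector hq hv)
    rw [map_add, map_smul] at h1
    refine (congrArg (· ∈ eigenRelations (loopX q) u _) (sub_eq_of_eq_add' h1)).mpr ?_
    exact hR _ _ _ _
  · have h1 := congrArg (Hom.comp (q := q) (b := 2) A) (idStarHom_rho_fusionVector hq hv)
    rw [map_add, map_smul] at h1
    refine (congrArg (· ∈ eigenRelations (loopX q) u _) (sub_eq_of_eq_add' h1)).mpr ?_
    exact hR _ _ _ _
  · have hne : q * (v ^ 2 - q ^ 2) ≠ 0 := mul_ne_zero hq (sub_ne_zero.2 hvq)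
    have h1 : C ⊙ starHom hq Y ⊙ fusionVector q v = fusionVector q v :=
      (assoc_of_eq_one h _).trans (idm_comp _)
    rw [smul_comp, Hom.comp_assoc]
    have h2 : Hom.comp (q := q) (b := 2) (pc q .cap 0 2 0)
      (C ⊙ starHom hq Y ⊙ fusionVector q v) = _ :=
      (congrArg (Hom.comp (q := q) (b := 2) (pc q .cap 0 2 0)) h1).trans (cap_fusionVector hq hv)
    rw [h2, smul_add, smul_smul, inv_mul_cancel₀ hne, one_smul, comp_add, comp_idm,
      add_sub_cancel_left, comp_smul, comp_smul, map_sub, comp_smul, comp_idm]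
    exact complex_smul_mem _ _ (complex_smul_mem _ _ (comp_sub_smul_mem_eigenRelations _ _ _))

end fusion

end AnnularSkein

end

theorem mainTheorem5 (q v : ℂ) (hq : q ≠ 0) (hv : v ≠ 0) (hvq : v ^ 2 ≠ q ^ 2) (k : ℕ) :
    (∃ f : AnnularSkein.Fusion q (2 * k) 1
          (AnnularSkein.VEven q (q * v + q⁻¹ * v⁻¹) (2 * k)) (AnnularSkein.VOdd q v 1)
        →ₗ[AnnularSkein.TL q (2 * k + 1)] AnnularSkein.VOdd q v (2 * k + 1),
        Function.Surjective f) ∧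
    (∃ f : AnnularSkein.Fusion q (2 * k + 1) 1
          (AnnularSkein.VOdd q v (2 * k + 1)) (AnnularSkein.VOdd q v⁻¹ 1)
        →ₗ[AnnularSkein.TL q (2 * k + 2)]
          AnnularSkein.VEven q (q * v + q⁻¹ * v⁻¹) (2 * k + 2),
        Function.Surjective f) := by
  exact ⟨AnnularSkein.exists_surjective_fusion_odd hq hv (zero_add _).symm,
    AnnularSkein.exists_surjective_fusion_even hq hv hvq (add_comm _ _)⟩
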